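/- Let $\mathbf Q(x,t)=\begin{pmatrix} q_1&q_0\\ q_0&q_{-1}\end{pmatrix}$ be a classical solution on $\mathbb R\times\mathbb R$ of the spin-1 Gross--Pitaevskii equation $$\mathrm i\,\mathbf Q_t+\mathbf Q_{xx}+2\mathbf Q\mathbf Q^\dagger\mathbf Q=\mathbf 0$$ ($\mathbf Q,\mathbf Q_x,\mathbf Q_{xx}$ jointly continuous) such that, for each $t$, $\mathbf Q(\cdot,t)\in L^1(\mathbb R)$ and $\mathbf Q,\mathbf Q_x\to\mathbf 0$ as $x\to\pm\infty$, and such that $\mathbf Q,\mathbf Q_x$ are bounded on $\mathbb R\times[-T,T]$ for every $T$. Consider the Lax pair $$\psi_x=(-\mathrm i\lambda\sigma+\mathbf U)\psi,\qquad \psi_t=\bigl(-2\mathrm i\lambda^2\sigma+2\lambda\mathbf U+\mathrm i\sigma(\mathbf U_x-\mathbf U^2)\bigr)\psi,$$ $$\sigma=\begin{pmatrix}\mathbf I_2&\mathbf 0\\ \mathbf 0&-\mathbf I_2\end{pmatrix},\qquad \mathbf U=\begin{pmatrix}\mathbf 0&\mathbf Q\\ -\mathbf Q^\dagger&\mathbf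 0\end{pmatrix},\qquad \theta=\lambda x+2\lambda^2t .$$ Let $\psi_{\pm\mathrm L}$ and $\psi_{\pm\mathrm R}$ (first and last two columns of the Jost solutions) be its $4\times2$ matrix solutions with, for every $t$, $$\mathrm e^{\mathrm i\theta}\psi_{\pm\mathrm L}\to\begin{pmatrix}\mathbf I_2\\ \mathbf 0\end{pmatrix},\qquad \mathrm e^{-\mathrm i\theta}\psi_{\pm\mathrm R}\to\begin{pmatrix}\mathbf 0\\ \mathbf I_2\end{pmatrix}\qquad (x\to\pm\infty);$$ $\psi_{-\mathrm L},\psi_{+\mathrm R}$ are taken for $\operatorname{Im}\lambda\ge 0$ and $\psi_{+\mathrm L},\psi_{-\mathrm R}$ for $\operatorname{Im}\lambda\le 0$. Put $$\mathbf a(\lambda)=\psi_{+\mathrm L}^\dagger(x,t;\bar\lambda)\,\psi_{-\mathrm L}(x,t;\lambda),\qquad \operatorname{Im}\lambda\ge0,$$ which does not depend on $(x,t)$; it is the analytic continuation of the upper left $2\times 2$ block of the scattering matrix. Let $m\ge 0$ and let $\lambda_0$, $\operatorname{Im}\lambda_0>0$, be a zero of $\det\mathbf a(\lambda)$ of multiplicity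 $m+1$. Then there exist symmetric matrices $\mathbf B_0,\dots,\mathbf B_m\in\mathbb C^{2\times2}$, independent of $(x,t)$, such that $\mathbf B_0\ne\mathbf 0$ if and only if $\mathbf a(\lambda_0)\neq\mathbf 0$, and such that for all $n\in\{0,\dots,m\}$ and all $(x,t)\in\mathbb R^2$ $$\frac1{n!}\,\partial_\lambda^n\bigl[\psi_{-\mathrm L}(x,t;\lambda)\,\mathrm{adj}\,\mathbf a(\lambda)\bigr]_{\lambda=\lambda_0}=\sum_{\substack{j+k=n\\ j,k\ge0}}\frac{\psi_{+\mathrm R}^{(k)}(x,t;\lambda_0)\,\mathbf B_j}{j!\,k!},$$ $$\frac1{n!}\,\partial_z^n\bigl[\psi_{-\mathrm R}(x,t;z)\,\mathrm{adj}\,\overline{\mathbf a(\bar z)}\bigr]_{z=\bar\lambda_0}=-\sum_{\substack{j+k=n\\ j,k\ge0}}\frac{\psi_{+\mathrm L}^{(k)}(x,t;\bar\lambda_0)\,\mathbf B_j^\dagger}{j!\,k!}.$$ Here $^{(k)}$ is the $k$-th derivative in the spectral parameter, $\overline{\mathbf a}$ is the entrywise conjugate and $^\dagger$ the conjugate transpose.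 -/

import Mathlib

noncomputable section

/-- The index set of `ℂ⁴ = ℂ² ⊕ ℂ²`: the left summand is "up" (or "left"), the right one "down"
(or "right"), so that `4 × 4` matrices come with their `2 × 2` blocks. -/
abbrev BlockIdx : Type := Fin 2 ⊕ Fin 2

/-- Entrywise partial derivative in `x` of a matrix function of `(x, t)`. -/
def matDx (Q : ℝ → ℝ → Matrix (Fin 2) (Fin 2) ℂ) (x t : ℝ) : Matrix (Fin 2) (Fin 2) ℂ :=
  Matrix.of fun i j => deriv (fun y => Q y t i j) x

/-- Entrywise partial derivative in `t` of a matrix function of `(x, t)`. -/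
def matDt (Q : ℝ → ℝ → Matrix (Fin 2) (Fin 2) ℂ) (x t : ℝ) : Matrix (Fin 2) (Fin 2) ℂ :=
  Matrix.of fun i j => deriv (fun s => Q x s i j) t

/-- `Q` is a classical solution on `ℝ × ℝ` of the spin-1 Gross–Pitaevskii equation
`i Q_t + Q_xx + 2 Q Q† Q = 0`, with values in the symmetric `2 × 2` matrices
`[[q₁, q₀], [q₀, q₋₁]]`, integrable in `x`, and vanishing at `x → ±∞` together with `Q_x`. -/
structure IsDecayingGPSolution (Q : ℝ → ℝ → Matrix (Fin 2) (Fin 2) ℂ) : Prop where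
  symm : ∀ x t, (Q x t).IsSymm
  contDiff_x : ∀ i j t, ContDiff ℝ 2 fun x => Q x t i j
  differentiable_t : ∀ i j x, Differentiable ℝ fun t => Q x t i j
  continuous_Q : Continuous fun p : ℝ × ℝ => Q p.1 p.2
  continuous_dx : Continuous fun p : ℝ × ℝ => matDx Q p.1 p.2
  continuous_dxx : Continuous fun p : ℝ × ℝ => matDx (matDx Q) p.1 p.2
  equation : ∀ x t, Complex.I • matDt Q x t + matDx (matDx Q) x t
    + (2 : ℂ) • (Q x t * (Q x t).conjTranspose * Q x t) = 0
  integrable : ∀ i j t, MeasureTheory.Integrable fun x => Q x t i j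
  decay : ∀ t, Filter.Tendsto (fun x => Q x t) (Filter.cocompact ℝ) (nhds 0)
  decay_dx : ∀ t, Filter.Tendsto (fun x => matDx Q x t) (Filter.cocompact ℝ) (nhds 0)
  locally_bounded : ∀ T : ℝ, ∃ C : ℝ, ∀ x t i j, |t| ≤ T →
    ‖Q x t i j‖ ≤ C ∧ ‖matDx Q x t i j‖ ≤ C

/-- `σ = diag(I₂, -I₂)`. -/
def laxSigma : Matrix BlockIdx BlockIdx ℂ := Matrix.fromBlocks 1 0 0 (-1)

/-- The matrix `[[0, q], [-q†, 0]]`; it is `U` for `q = Q` and `U_x` for `q = Q_x`. -/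
def laxU (q : Matrix (Fin 2) (Fin 2) ℂ) : Matrix BlockIdx BlockIdx ℂ :=
  Matrix.fromBlocks 0 q (-q.conjTranspose) 0

/-- The coefficient `-iλσ + U` of the `x`-part of the Lax pair. -/
def laxX (Q : ℝ → ℝ → Matrix (Fin 2) (Fin 2) ℂ) (x t : ℝ) (lam : ℂ) :
    Matrix BlockIdx BlockIdx ℂ :=
  (-Complex.I * lam) • laxSigma + laxU (Q x t)

/-- The coefficient `-2iλ²σ + 2λU + iσ(U_x - U²)` of the `t`-part of the Lax pair. -/
def laxT (Q : ℝ → ℝ → Matrix (Fin 2) (Fin 2) ℂ) (x t : ℝ) (lam : ℂ) :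
    Matrix BlockIdx BlockIdx ℂ :=
  (-2 * Complex.I * lam ^ 2) • laxSigma + (2 * lam) • laxU (Q x t)
    + Complex.I • (laxSigma * (laxU (matDx Q x t) - laxU (Q x t) * laxU (Q x t)))

/-- `θ(x,t;λ) = λx + 2λ²t`. -/
def gpTheta (x t : ℝ) (lam : ℂ) : ℂ := lam * x + 2 * lam ^ 2 * t

/-- `ψ` (two columns) solves both equations of the Lax pair at the spectral parameter `lam`, and
`exp(i ε θ) ψ → E` as `x → l`, for every `t`. -/
structure IsJostBlock (Q : ℝ → ℝ → Matrix (Fin 2) (Fin 2) ℂ) (l : Filter ℝ) (ε : ℂ)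
    (E : Matrix BlockIdx (Fin 2) ℂ) (lam : ℂ) (ψ : ℝ → ℝ → Matrix BlockIdx (Fin 2) ℂ) :
    Prop where
  x_part : ∀ x t i j, HasDerivAt (fun y => ψ y t i j) ((laxX Q x t lam * ψ x t) i j) x
  t_part : ∀ x t i j, HasDerivAt (fun s => ψ x s i j) ((laxT Q x t lam * ψ x t) i j) t
  normalization : ∀ t,
    Filter.Tendsto (fun x => Complex.exp (Complex.I * ε * gpTheta x t lam) • ψ x t) l (nhds E)

/-- The solution singled out by `IsJostBlock`. For decaying solutions `Q` it exists and is unique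
when `lam` is in the closed half plane in which the corresponding columns are continued. -/
def jostBlock (Q : ℝ → ℝ → Matrix (Fin 2) (Fin 2) ℂ) (l : Filter ℝ) (ε : ℂ)
    (E : Matrix BlockIdx (Fin 2) ℂ) (lam : ℂ) : ℝ → ℝ → Matrix BlockIdx (Fin 2) ℂ :=
  Classical.epsilon (IsJostBlock Q l ε E lam)

/-- `ψ_{-L}(x,t;λ)`, for `Im λ ≥ 0`: first two columns, normalized at `x → -∞`. -/
def psiMinusL (Q : ℝ → ℝ → Matrix (Fin 2) (Fin 2) ℂ) (x t : ℝ) (lam : ℂ) :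
    Matrix BlockIdx (Fin 2) ℂ :=
  jostBlock Q Filter.atBot 1 (Matrix.fromRows 1 0) lam x t

/-- `ψ_{-R}(x,t;λ)`, for `Im λ ≤ 0`: last two columns, normalized at `x → -∞`. -/
def psiMinusR (Q : ℝ → ℝ → Matrix (Fin 2) (Fin 2) ℂ) (x t : ℝ) (lam : ℂ) :
    Matrix BlockIdx (Fin 2) ℂ :=
  jostBlock Q Filter.atBot (-1) (Matrix.fromRows 0 1) lam x t

/-- `ψ_{+L}(x,t;λ)`, for `Im λ ≤ 0`: first two columns, normalized at `x → +∞`. -/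
def psiPlusL (Q : ℝ → ℝ → Matrix (Fin 2) (Fin 2) ℂ) (x t : ℝ) (lam : ℂ) :
    Matrix BlockIdx (Fin 2) ℂ :=
  jostBlock Q Filter.atTop 1 (Matrix.fromRows 1 0) lam x t

/-- `ψ_{+R}(x,t;λ)`, for `Im λ ≥ 0`: last two columns, normalized at `x → +∞`. -/
def psiPlusR (Q : ℝ → ℝ → Matrix (Fin 2) (Fin 2) ℂ) (x t : ℝ) (lam : ℂ) :
    Matrix BlockIdx (Fin 2) ℂ :=
  jostBlock Q Filter.atTop (-1) (Matrix.fromRows 0 1) lam x t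

/-- `a(λ) = ψ_{+L}(x,t;λ̄)† ψ_{-L}(x,t;λ)` for `Im λ ≥ 0`. The product does not depend on `(x,t)`,
by the Lax pair, and is evaluated at `(0,0)`. On the real line `ψ_+` is unitary, and this is the
upper left block of the scattering matrix `S = ψ_+⁻¹ ψ_-`. -/
def scatA (Q : ℝ → ℝ → Matrix (Fin 2) (Fin 2) ℂ) (lam : ℂ) : Matrix (Fin 2) (Fin 2) ℂ :=
  (psiPlusL Q 0 0 (starRingEnd ℂ lam)).conjTranspose * psiMinusL Q 0 0 lam

/-- The entrywise complex conjugate `ā(z̄)`, as a function of `z` with `Im z ≤ 0`. -/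
def scatAConj (Q : ℝ → ℝ → Matrix (Fin 2) (Fin 2) ℂ) (z : ℂ) : Matrix (Fin 2) (Fin 2) ℂ :=
  (scatA Q (starRingEnd ℂ z)).map (starRingEnd ℂ)

/-- Entrywise `n`-th complex derivative of a matrix function of the spectral parameter. -/
def matIterDeriv {m k : Type*} (n : ℕ) (F : ℂ → Matrix m k ℂ) (z : ℂ) : Matrix m k ℂ :=
  Matrix.of fun i j => iteratedDeriv n (fun w => F w i j) z

end

/-! Let J be the standard symplectic form. Because Q is symmetric, both Lax coefficients lie in the
symplectic Lie algebra of J, so the fundamental solution Φ (`laxFlow`), equal to 1 at the origin, is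
symplectic. It is entire in λ, and the zero curvature condition makes it solve the t-equation as
well. The Jost solutions are ψ_{-L} = Φ p and ψ_{+R} = Φ r, so the problem reduces to two functions
of λ alone, p = `coeffMinusL` and r = `coeffPlusR`.

These are limits of entire functions (`jostApprox`). For Im λ ≥ 0 the x-equation multiplied by
exp(iεθ) is dissipative in the direction away from the normalization, since U is skew-Hermitian. The
error is therefore at most a tail of the integral of |Q|, uniformly in λ, which gives existence,
uniqueness and analyticity of p and r. A Grönwall estimate carries the normalization from t = 0 to
every t.

The ranges of p and r are isotropic planes, and the reflection ψ ↦ Jψ̄ between λ and λ̄ gives a =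
rᵀJp (`scatA_eq`), an expression holomorphic in λ. Take the fixed isotropic plane spanned by c = -J
r̄(λ₀), which is transversal to r(λ) near λ₀. Decomposing p along c and r
(`isotropic_decomposition`), the c-component of p is a multiple of a, so after multiplication by adj
a it carries the factor det a: p adj a = det a · (analytic) + r β. Derivatives of order at most m of
the first term vanish at λ₀, and the Leibniz rule applied to Φ r β gives the first expansion with
B_j = β^{(j)}(λ₀). Isotropy of p makes β symmetric (`isSymm_component`), and the reflection then
turns the first expansion into the second one. Finally, p(λ₀) is injective and adj adj a = a for 2 ×
2 matrices, so β(λ₀) = 0 exactly when a(λ₀) = 0 (`normingFunction_eq_zero_iff`). -/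

open scoped Topology

/-! ### Linear equations with a parameter: the Peano–Baker series. -/

noncomputable section LinearODE

variable {𝒜 Y : Type*} [NormedRing 𝒜] [NormedAlgebra ℝ 𝒜] [CompleteSpace 𝒜] [TopologicalSpace Y]

/-- The terms of the Peano–Baker series of the linear equation `f' = A f`. -/
def peanoBaker (A : ℝ → Y → 𝒜) : ℕ → ℝ → Y → 𝒜
  | 0 => fun _ _ => 1
  | n + 1 => fun x p => ∫ y in (0 : ℝ)..x, A y p * peanoBaker A n y p

omit [CompleteSpace 𝒜] in
theorem continuous_peanoBaker {A : ℝ → Y → 𝒜} (hA : Continuous fun q : ℝ × Y => A q.1 q.2) (n : ℕ) :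
    Continuous fun q : ℝ × Y => peanoBaker A n q.1 q.2 := by
  induction n with
  | zero => exact continuous_const
  | succ n ih =>
    have h : Continuous (Function.uncurry fun (q : ℝ × Y) (y : ℝ) =>
        A y q.2 * peanoBaker A n y q.2) := by
      have e : Continuous fun z : (ℝ × Y) × ℝ => ((z.2, z.1.2) : ℝ × Y) := by fun_prop
      exact (hA.comp e).mul (ih.comp e)
    exact intervalIntegral.continuous_parametric_intervalIntegral_of_continuous h continuous_fst

theorem hasDerivAt_peanoBaker_succ {A : ℝ → Y → 𝒜}
    (hA : Continuous fun q : ℝ × Y => A q.1 q.2) (n : ℕ) (x : ℝ) (p : Y) :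
    HasDerivAt (fun y => peanoBaker A (n + 1) y p) (A x p * peanoBaker A n x p) x := by
  have e : Continuous fun y : ℝ => ((y, p) : ℝ × Y) := by fun_prop
  have h : Continuous fun y : ℝ => A y p * peanoBaker A n y p :=
    (hA.comp e).mul ((continuous_peanoBaker hA n).comp e)
  exact intervalIntegral.integral_hasDerivAt_right (h.intervalIntegrable _ _)
    (h.stronglyMeasurableAtFilter _ _) h.continuousAt

-- Each integration of the previous bound between 0 and x contributes one factor K|x|/(n+1). The
-- factor ‖1‖ stays because the norm of the unit is not assumed to be 1.
omit [CompleteSpace 𝒜] [TopologicalSpace Y] in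
theorem norm_peanoBaker_le {A : ℝ → Y → 𝒜} {p : Y} {r K : ℝ}
    (hK : ∀ y, |y| ≤ r → ‖A y p‖ ≤ K) (n : ℕ) (x : ℝ) (hx : |x| ≤ r) :
    ‖peanoBaker A n x p‖ ≤ ‖(1 : 𝒜)‖ * ((K * |x|) ^ n / n.factorial) := by
  have hK0 : 0 ≤ K := (norm_nonneg _).trans (hK x hx)
  induction n generalizing x with
  | zero => simp [peanoBaker]
  | succ n ih =>
    have hc : Continuous fun y : ℝ =>
        K * (‖(1 : 𝒜)‖ * ((K * |y - 0|) ^ n / n.factorial)) := by fun_prop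
    calc ‖peanoBaker A (n + 1) x p‖
        ≤ ∫ y in Set.uIoc 0 x, K * (‖(1 : 𝒜)‖ * ((K * |y - 0|) ^ n / n.factorial)) := by
          refine (intervalIntegral.norm_intervalIntegral_eq _ _ _ _).le.trans ?_
          refine MeasureTheory.norm_integral_le_of_norm_le ?_ ?_
          · exact (hc.intervalIntegrable 0 x).def'
          · refine (MeasureTheory.ae_restrict_mem measurableSet_uIoc).mono fun y hy => ?_
            have hy' : |y| ≤ |x| := by
              rcases Set.mem_uIoc.1 hy with h | h
              · rw [abs_of_pos h.1]; exact h.2.trans (le_abs_self x)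
              · rw [abs_of_nonpos h.2, abs_of_neg (h.1.trans_le h.2)]; linarith [h.1]
            refine (norm_mul_le _ _).trans ?_
            rw [sub_zero]
            exact mul_le_mul (hK y (hy'.trans hx)) (ih y (hy'.trans hx)) (norm_nonneg _) hK0
      _ = ∫ y in Set.uIoc 0 x, (K * ‖(1 : 𝒜)‖ * K ^ n / n.factorial) * |y - 0| ^ n := by
          congr 1; ext y; rw [mul_pow]; ring
      _ = _ := by
          rw [MeasureTheory.integral_const_mul, integral_pow_abs_sub_uIoc, sub_zero, mul_pow,
            Nat.factorial_succ]
          push_cast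
          field_simp
          ring

/-- The fundamental solution of a linear equation with parameters, as a Peano–Baker series. -/
def fundSol (A : ℝ → Y → 𝒜) (x : ℝ) (p : Y) : 𝒜 := ∑' n, peanoBaker A n x p

variable {A : ℝ → Y → 𝒜}

-- Compactness of [-r, r] times a compact neighbourhood of the parameter. This supplies the constant
-- for the M-test, locally uniformly in the parameter.
omit [NormedAlgebra ℝ 𝒜] [CompleteSpace 𝒜] in
theorem exists_norm_le_of_continuous [LocallyCompactSpace Y]
    (hA : Continuous fun q : ℝ × Y => A q.1 q.2) (r : ℝ) (p : Y) :
    ∃ K, 0 ≤ K ∧ ∃ C ∈ 𝓝 p, ∀ q ∈ C, ∀ y, |y| ≤ r → ‖A y q‖ ≤ K := by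
  obtain ⟨C, hC, hCp⟩ := exists_compact_mem_nhds p
  obtain ⟨K, hK⟩ := ((isCompact_Icc (a := -r) (b := r)).prod hC).exists_bound_of_continuousOn
    hA.continuousOn
  exact ⟨max K 0, le_max_right _ _, C, hCp, fun q hq y hy =>
    (hK (y, q) ⟨abs_le.1 hy, hq⟩).trans (le_max_left _ _)⟩

omit [CompleteSpace 𝒜] [TopologicalSpace Y] in
theorem fundSol_zero (p : Y) : fundSol A 0 p = 1 := by
  rw [fundSol, tsum_eq_single 0]
  · rfl
  · intro n hn
    obtain ⟨k, rfl⟩ := Nat.exists_eq_succ_of_ne_zero hn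
    simp [peanoBaker]

theorem continuous_fundSol [LocallyCompactSpace Y]
    (hA : Continuous fun q : ℝ × Y => A q.1 q.2) :
    Continuous fun q : ℝ × Y => fundSol A q.1 q.2 := by
  rw [continuous_iff_continuousAt]
  rintro ⟨x, p⟩
  obtain ⟨K, hK0, C, hC, hK⟩ := exists_norm_le_of_continuous hA (|x| + 1) p
  have hN : (Metric.ball x 1) ×ˢ C ∈ 𝓝 (x, p) := prod_mem_nhds (Metric.ball_mem_nhds x one_pos) hC
  refine ContinuousOn.continuousAt (s := (Metric.ball x 1) ×ˢ C) ?_ hN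
  change ContinuousOn (fun q : ℝ × Y => ∑' n, peanoBaker A n q.1 q.2) _
  have hb : ∀ n : ℕ, ∀ z ∈ Metric.ball x 1 ×ˢ C, ‖peanoBaker A n z.1 z.2‖ ≤
      ‖(1 : 𝒜)‖ * ((K * (|x| + 1)) ^ n / n.factorial) := by
    rintro n ⟨y, q⟩ ⟨hy, hq⟩
    have hy' : |y| ≤ |x| + 1 := by
      have h1 : |y - x| < 1 := hy
      have h2 := abs_sub_abs_le_abs_sub y x
      linarith
    refine (norm_peanoBaker_le (hK q hq) n y hy').trans ?_
    gcongr
  exact continuousOn_tsum (fun n => (continuous_peanoBaker hA n).continuousOn)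
    ((Real.summable_pow_div_factorial _).mul_left _) hb

theorem hasDerivAt_fundSol [LocallyCompactSpace Y]
    (hA : Continuous fun q : ℝ × Y => A q.1 q.2) (x : ℝ) (p : Y) :
    HasDerivAt (fun y => fundSol A y p) (A x p * fundSol A x p) x := by
  obtain ⟨K, hK0, C, hC, hK⟩ := exists_norm_le_of_continuous hA (|x| + 1) p
  have hK := hK p (mem_of_mem_nhds hC)
  have hb : ∀ n y, |y| ≤ |x| + 1 →
      ‖peanoBaker A n y p‖ ≤ ‖(1 : 𝒜)‖ * ((K * (|x| + 1)) ^ n / n.factorial) := by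
    intro n y hy
    refine (norm_peanoBaker_le hK n y hy).trans ?_
    gcongr
  have hs0 : Summable fun n : ℕ => ‖(1 : 𝒜)‖ * ((K * (|x| + 1)) ^ n / n.factorial) :=
    (Real.summable_pow_div_factorial _).mul_left _
  have hmem : ∀ y ∈ Set.Ioo (-(|x| + 1)) (|x| + 1), |y| ≤ |x| + 1 :=
    fun y hy => (abs_lt.2 hy).le
  have hx : x ∈ Set.Ioo (-(|x| + 1)) (|x| + 1) := abs_lt.1 (lt_add_one _)
  have hsum : ∀ y, |y| ≤ |x| + 1 → Summable fun n => peanoBaker A n y p :=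
    fun y hy => Summable.of_norm_bounded hs0 fun n => hb n y hy
  -- Termwise differentiation of the series without its constant term: the derivative of term n + 1
  -- is A times term n, so the derivatives sum to A times the whole series.
  have key := hasDerivAt_tsum_of_isPreconnected (hs0.mul_left K) isOpen_Ioo
    (isPreconnected_Ioo (a := -(|x| + 1)) (b := |x| + 1))
    (fun n y _ => hasDerivAt_peanoBaker_succ hA n y p)
    (fun n y hy => (norm_mul_le _ _).trans
      (mul_le_mul (hK y (hmem y hy)) (hb n y (hmem y hy)) (norm_nonneg _) hK0))
    hx ((summable_nat_add_iff 1).2 (hsum x (hmem x hx))) hx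
  rw [(hsum x (hmem x hx)).tsum_mul_left] at key
  refine (key.const_add 1).congr_of_eventuallyEq ?_
  filter_upwards [isOpen_Ioo.mem_nhds hx] with y hy
  rw [fundSol, (hsum y (hmem y hy)).tsum_eq_zero_add]
  rfl

end LinearODE

/-! ### Differentiation with respect to the parameter. -/

section Parameter

variable {𝕜 𝒜 : Type*} [RCLike 𝕜] [NormedRing 𝒜] [NormedAlgebra ℝ 𝒜] [NormedSpace 𝕜 𝒜]
  [IsScalarTower 𝕜 𝒜 𝒜] [SMulCommClass 𝕜 𝒜 𝒜] [SMulCommClass ℝ 𝕜 𝒜] [CompleteSpace 𝒜]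

/-- Differentiability of the fundamental solution in a parameter. -/
theorem hasDerivAt_fundamental_param {A D F : ℝ → 𝕜 → 𝒜} {V : ℝ → 𝒜} {t : 𝕜}
    (hF : Continuous fun q : ℝ × 𝕜 => F q.1 q.2)
    (hD : Continuous fun q : ℝ × 𝕜 => D q.1 q.2)
    (hF0 : ∀ s, F 0 s = 1) (hFx : ∀ x s, HasDerivAt (fun y => F y s) (A x s * F x s) x)
    (hAD : ∀ y s, A y s - A y t = (s - t) • D y s)
    (hV0 : V 0 = 1) (hVx : ∀ x, HasDerivAt V (-(V x * A x t)) x)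
    (hFV : ∀ x, F x t * V x = 1) (x : ℝ) :
    HasDerivAt (fun s => F x s) (F x t * ∫ y in (0 : ℝ)..x, V y * D y t * F y t) t := by
  have hVc : Continuous V := continuous_iff_continuousAt.2 fun x => (hVx x).continuousAt
  have hc : Continuous fun q : 𝕜 × ℝ => V q.2 * D q.2 q.1 * F q.2 q.1 := by
    have e : Continuous fun q : 𝕜 × ℝ => ((q.2, q.1) : ℝ × 𝕜) := by fun_prop
    exact ((hVc.comp continuous_snd).mul (hD.comp e)).mul (hF.comp e)
  set I : 𝕜 → 𝒜 := fun s => ∫ y in (0 : ℝ)..x, V y * D y s * F y s with hI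
  have hIc : Continuous I :=
    intervalIntegral.continuous_parametric_intervalIntegral_of_continuous' hc 0 x
  -- Variation of constants: V F(·, s) has derivative (s - t) V D F(·, s), hence the increment in s
  -- is given by an exact formula, and differentiability at t only needs continuity of the integral
  -- `I`.
  have hrep : ∀ s, F x s = F x t + (s - t) • (F x t * I s) := by
    intro s
    have hd : ∀ y ∈ Set.uIcc 0 x, HasDerivAt (fun y => V y * F y s)
        ((s - t) • (V y * D y s * F y s)) y := by
      intro y _
      refine ((hVx y).mul (hFx y s)).congr_deriv ?_
      rw [← mul_assoc (V y) (A y s), neg_mul, neg_add_eq_sub, ← sub_mul, ← mul_sub, hAD,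
        mul_smul_comm, smul_mul_assoc]
    have hcs : Continuous fun y => V y * D y s * F y s :=
      hc.comp (by fun_prop : Continuous fun y : ℝ => ((s, y) : 𝕜 × ℝ))
    have h1 := intervalIntegral.integral_eq_sub_of_hasDerivAt hd
      ((hcs.const_smul (s - t)).intervalIntegrable _ _)
    rw [intervalIntegral.integral_smul, hV0, hF0, one_mul] at h1
    have h2 : V x * F x s = 1 + (s - t) • I s := by rw [hI, h1]; abel
    calc F x s = F x t * (V x * F x s) := by rw [← mul_assoc, hFV, one_mul]
      _ = _ := by rw [h2, mul_add, mul_one, mul_smul_comm]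
  rw [hasDerivAt_iff_tendsto_slope]
  have hlim : Filter.Tendsto (fun s => F x t * I s) (𝓝[≠] t) (𝓝 (F x t * I t)) :=
    (continuous_const.mul hIc).continuousAt.mono_left nhdsWithin_le_nhds
  refine hlim.congr' ?_
  filter_upwards [self_mem_nhdsWithin] with s hs
  rw [slope_def_module, hrep s, add_sub_cancel_left, smul_smul,
    inv_mul_cancel₀ (sub_ne_zero.2 hs), one_smul]

end Parameter

/-! ### The symplectic fundamental solution of the Lax pair. -/

noncomputable section LaxFlow

attribute [local instance] Matrix.linftyOpNormedRing Matrix.linftyOpNormedAlgebra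

open Matrix

theorem hasDerivAt_matrix_iff {𝕜 m : Type*} [RCLike 𝕜] [NormedSpace 𝕜 ℂ]
    [Fintype m] [DecidableEq m] {M : 𝕜 → Matrix m m ℂ} {M' : Matrix m m ℂ} {x : 𝕜} :
    HasDerivAt M M' x ↔ ∀ i j, HasDerivAt (fun y => M y i j) (M' i j) x :=
  (hasDerivAt_pi (φ := fun y => (M y : m → m → ℂ)) (φ' := M')).trans
    (forall_congr' fun _ => hasDerivAt_pi)

theorem laxSigma_mul_self : laxSigma * laxSigma = 1 := by
  simp [laxSigma, fromBlocks_multiply]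

theorem laxU_mul_laxSigma (q : Matrix (Fin 2) (Fin 2) ℂ) :
    laxU q * laxSigma = -(laxSigma * laxU q) := by
  simp [laxSigma, laxU, fromBlocks_multiply, fromBlocks_neg]

theorem laxSigma_transpose_mul_J :
    laxSigmaᵀ * J (Fin 2) ℂ = -(J (Fin 2) ℂ * laxSigma) := by
  simp [laxSigma, J, fromBlocks_transpose, fromBlocks_multiply, fromBlocks_neg]

/-- This is the place where symmetry of the potential enters: it puts U into the symplectic Lie
algebra. -/
theorem laxU_transpose_mul_J {q : Matrix (Fin 2) (Fin 2) ℂ} (hq : q.IsSymm) :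
    (laxU q)ᵀ * J (Fin 2) ℂ = -(J (Fin 2) ℂ * laxU q) := by
  have h : (qᴴ)ᵀ = qᴴ := by
    ext i j
    simp [← hq.apply i j]
  simp [laxU, J, fromBlocks_transpose, fromBlocks_multiply, fromBlocks_neg, hq.eq, h]

variable {Q : ℝ → ℝ → Matrix (Fin 2) (Fin 2) ℂ}

theorem laxX_transpose_mul_J (hQ : IsDecayingGPSolution Q) (x t : ℝ) (lam : ℂ) :
    (laxX Q x t lam)ᵀ * J (Fin 2) ℂ = -(J (Fin 2) ℂ * laxX Q x t lam) := by
  simp only [laxX, transpose_add, transpose_smul, add_mul, mul_add, smul_mul_assoc,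
    mul_smul_comm, laxSigma_transpose_mul_J, laxU_transpose_mul_J (hQ.symm x t)]
  module

theorem matDx_isSymm (hQ : IsDecayingGPSolution Q) (x t : ℝ) : (matDx Q x t).IsSymm := by
  ext i j
  simp only [matDx, transpose_apply, of_apply]
  congr 1
  ext y
  exact (hQ.symm y t).apply i j

/-- The terms σU_x and σU² are products of Lie algebra elements, which need not stay in the algebra;
they do because U and U_x anticommute with σ. -/
theorem laxT_transpose_mul_J (hQ : IsDecayingGPSolution Q) (x t : ℝ) (lam : ℂ) :
    (laxT Q x t lam)ᵀ * J (Fin 2) ℂ = -(J (Fin 2) ℂ * laxT Q x t lam) := by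
  have hs := laxSigma_transpose_mul_J
  have hu := laxU_transpose_mul_J (hQ.symm x t)
  have hv := laxU_transpose_mul_J (matDx_isSymm hQ x t)
  have cu := laxU_mul_laxSigma (Q x t)
  have cv := laxU_mul_laxSigma (matDx Q x t)
  simp only [laxT]
  generalize laxU (Q x t) = u at *
  generalize laxU (matDx Q x t) = v at *
  generalize J (Fin 2) ℂ = K at *
  generalize laxSigma = s at *
  have h1 : (s * v)ᵀ * K = -(K * (s * v)) := by
    rw [transpose_mul, mul_assoc, hs, mul_neg, ← mul_assoc, hv, neg_mul, neg_neg, mul_assoc, cv,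
      mul_neg]
  have h2 : (s * (u * u))ᵀ * K = -(K * (s * (u * u))) := by
    rw [transpose_mul, transpose_mul, mul_assoc, hs, mul_neg, mul_assoc, ← mul_assoc uᵀ K s, hu,
      neg_mul, mul_neg, neg_neg, mul_assoc, cu, mul_neg, mul_neg, ← mul_assoc, hu, neg_mul,
      neg_neg, mul_assoc, ← mul_assoc u s u, cu]
    simp [mul_assoc]
  simp only [mul_sub, transpose_add, transpose_sub, transpose_smul, add_mul, sub_mul, mul_add,
    smul_mul_assoc, mul_smul_comm, hs, hu, h1, h2]
  module

theorem hasDerivAt_laxU {q : ℝ → Matrix (Fin 2) (Fin 2) ℂ} {q' : Matrix (Fin 2) (Fin 2) ℂ} {x : ℝ}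
    (h : ∀ i j, HasDerivAt (fun y => q y i j) (q' i j) x) :
    HasDerivAt (fun y => laxU (q y)) (laxU q') x := by
  refine hasDerivAt_matrix_iff.2 fun i j => ?_
  rcases i with i | i <;> rcases j with j | j
  · simpa [laxU] using hasDerivAt_const x (0 : ℂ)
  · simpa [laxU] using h i j
  · simpa [laxU] using (h j i).star.fun_neg
  · simpa [laxU] using hasDerivAt_const x (0 : ℂ)

theorem hasDerivAt_Q_x (hQ : IsDecayingGPSolution Q) (x t : ℝ) (i j : Fin 2) :
    HasDerivAt (fun y => Q y t i j) (matDx Q x t i j) x :=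
  (((hQ.contDiff_x i j t).differentiable (by norm_num)) x).hasDerivAt

theorem hasDerivAt_matDx_x (hQ : IsDecayingGPSolution Q) (x t : ℝ) (i j : Fin 2) :
    HasDerivAt (fun y => matDx Q y t i j) (matDx (matDx Q) x t i j) x := by
  have h : ContDiff ℝ 1 (deriv fun y => Q y t i j) :=
    ((contDiff_succ_iff_deriv (n := 1)).1 (hQ.contDiff_x i j t)).2.2
  exact ((h.differentiable (by norm_num)) x).hasDerivAt

theorem hasDerivAt_Q_t (hQ : IsDecayingGPSolution Q) (x t : ℝ) (i j : Fin 2) :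
    HasDerivAt (fun s => Q x s i j) (matDt Q x t i j) t :=
  (hQ.differentiable_t i j x t).hasDerivAt

theorem matDt_eq (hQ : IsDecayingGPSolution Q) (x t : ℝ) :
    matDt Q x t = Complex.I • (matDx (matDx Q) x t + (2 : ℂ) • (Q x t * (Q x t)ᴴ * Q x t)) := by
  have h := congrArg (fun M => (-Complex.I) • M) (hQ.equation x t)
  simp only [smul_add, smul_zero, smul_smul, neg_mul, Complex.I_mul_I, neg_neg, one_smul] at h
  rw [smul_add, smul_smul, ← sub_eq_zero, ← h]
  module

theorem continuous_laxU {X : Type*} [TopologicalSpace X] {q : X → Matrix (Fin 2) (Fin 2) ℂ}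
    (hq : Continuous q) : Continuous fun x => laxU (q x) :=
  Continuous.matrix_fromBlocks continuous_const hq hq.matrix_conjTranspose.neg continuous_const

/-- Continuity of Q_t is not a hypothesis; the evolution equation expresses Q_t through Q and Q_xx.
-/
theorem continuous_matDt (hQ : IsDecayingGPSolution Q) :
    Continuous fun p : ℝ × ℝ => matDt Q p.1 p.2 := by
  simp only [matDt_eq hQ]
  have h := hQ.continuous_Q
  exact (hQ.continuous_dxx.add (((h.matrix_mul h.matrix_conjTranspose).matrix_mul h).const_smul
    (2 : ℂ))).const_smul Complex.I

theorem continuous_laxX (hQ : IsDecayingGPSolution Q) :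
    Continuous fun p : ℝ × (ℝ × ℂ) => laxX Q p.1 p.2.1 p.2.2 := by
  have e : Continuous fun p : ℝ × (ℝ × ℂ) => (p.1, p.2.1) := by fun_prop
  have h := continuous_laxU (hQ.continuous_Q.comp e)
  unfold laxX
  exact ((continuous_const.mul continuous_snd.snd).smul continuous_const).add h

theorem continuous_laxT (hQ : IsDecayingGPSolution Q) :
    Continuous fun p : ℝ × (ℝ × ℂ) => laxT Q p.1 p.2.1 p.2.2 := by
  have e : Continuous fun p : ℝ × (ℝ × ℂ) => (p.1, p.2.1) := by fun_prop
  have h := continuous_laxU (hQ.continuous_Q.comp e)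
  have h' := continuous_laxU (hQ.continuous_dx.comp e)
  unfold laxT
  exact (((continuous_const.mul (continuous_snd.snd.pow 2)).smul continuous_const).add
    ((continuous_const.mul continuous_snd.snd).smul h)).add
    ((continuous_const.matrix_mul (h'.sub (h.matrix_mul h))).fun_const_smul _)

/-- The evolution equation in block form, U_t = iσ(U_xx - 2U³), as needed for the zero curvature
condition. -/
theorem laxU_matDt (hQ : IsDecayingGPSolution Q) (x t : ℝ) :
    laxU (matDt Q x t) = Complex.I • (laxSigma * (laxU (matDx (matDx Q) x t)
      - (2 : ℂ) • (laxU (Q x t) * laxU (Q x t) * laxU (Q x t)))) := by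
  rw [matDt_eq hQ]
  simp only [laxSigma, laxU, fromBlocks_multiply, fromBlocks_smul, sub_eq_add_neg, fromBlocks_neg,
    fromBlocks_add, conjTranspose_smul, conjTranspose_add, conjTranspose_mul,
    conjTranspose_conjTranspose]
  congr 1
  · simp
  · simp
  · simp [mul_assoc]
  · simp

/-- The zero curvature condition of the Lax pair. -/
theorem hasDerivAt_laxT_x (hQ : IsDecayingGPSolution Q) (x t : ℝ) (lam : ℂ) :
    HasDerivAt (fun y => laxT Q y t lam) (laxU (matDt Q x t)
      + laxX Q x t lam * laxT Q x t lam - laxT Q x t lam * laxX Q x t lam) x := by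
  have hu := hasDerivAt_laxU (hasDerivAt_Q_x hQ x t)
  have hv := hasDerivAt_laxU (hasDerivAt_matDx_x hQ x t)
  have key := ((hasDerivAt_const x ((-2 * Complex.I * lam ^ 2) • laxSigma)).add
    (hu.const_smul (2 * lam))).add
    (((hv.sub (hu.mul hu)).const_mul laxSigma).const_smul Complex.I)
  refine key.congr_deriv ?_
  rw [laxU_matDt hQ]
  have ss := laxSigma_mul_self
  have cu := laxU_mul_laxSigma (Q x t)
  have cv := laxU_mul_laxSigma (matDx Q x t)
  simp only [laxT, laxX]
  generalize laxU (Q x t) = u at *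
  generalize laxU (matDx Q x t) = v at *
  generalize laxU (matDx (matDx Q) x t) = w at *
  generalize laxSigma = s at *
  have su : ∀ z, u * (s * z) = -(s * (u * z)) := fun z => by
    rw [← mul_assoc, cu, neg_mul, mul_assoc]
  have ss' : ∀ z, s * (s * z) = z := fun z => by rw [← mul_assoc, ss, one_mul]
  -- Normal form with all factors σ moved to the left and σ² = 1 removed; what remains is an
  -- identity of coefficients, using i² = -1.
  simp only [mul_add, add_mul, mul_sub, sub_mul, smul_mul_assoc, mul_smul_comm, mul_assoc, cu, cv,
    su, ss, ss', mul_neg, neg_neg, zero_add]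
  simp only [smul_add, smul_sub, smul_neg, smul_smul]
  ring_nf
  simp only [Complex.I_sq]
  module

/-- The fundamental solution of the `x`-part of the Lax pair. -/
def xFlow (Q : ℝ → ℝ → Matrix (Fin 2) (Fin 2) ℂ) (x : ℝ) (p : ℝ × ℂ) :
    Matrix BlockIdx BlockIdx ℂ :=
  fundSol (fun x (p : ℝ × ℂ) => laxX Q x p.1 p.2) x p

/-- The fundamental solution of the `t`-part of the Lax pair at `x = 0`. -/
def tFlow (Q : ℝ → ℝ → Matrix (Fin 2) (Fin 2) ℂ) (t : ℝ) (lam : ℂ) :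
    Matrix BlockIdx BlockIdx ℂ :=
  fundSol (fun t lam => laxT Q 0 t lam) t lam

theorem continuous_xFlow (hQ : IsDecayingGPSolution Q) :
    Continuous fun p : ℝ × (ℝ × ℂ) => xFlow Q p.1 p.2 :=
  continuous_fundSol (continuous_laxX hQ)

theorem continuous_laxT_zero (hQ : IsDecayingGPSolution Q) :
    Continuous fun p : ℝ × ℂ => laxT Q 0 p.1 p.2 := by
  have e : Continuous fun p : ℝ × ℂ => ((0 : ℝ), p) := continuous_const.prodMk continuous_id
  have h := (continuous_laxT hQ).comp e
  simpa only [Function.comp_def] using h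

theorem hasDerivAt_xFlow (hQ : IsDecayingGPSolution Q) (x : ℝ) (p : ℝ × ℂ) :
    HasDerivAt (fun y => xFlow Q y p) (laxX Q x p.1 p.2 * xFlow Q x p) x :=
  hasDerivAt_fundSol (continuous_laxX hQ) x p

theorem hasDerivAt_tFlow (hQ : IsDecayingGPSolution Q) (t : ℝ) (lam : ℂ) :
    HasDerivAt (fun s => tFlow Q s lam) (laxT Q 0 t lam * tFlow Q t lam) t :=
  hasDerivAt_fundSol (continuous_laxT_zero hQ) t lam

theorem xFlow_zero (p : ℝ × ℂ) : xFlow Q 0 p = 1 := fundSol_zero p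

theorem tFlow_zero (lam : ℂ) : tFlow Q 0 lam = 1 := fundSol_zero lam

theorem hasDerivAt_transpose {M : ℝ → Matrix BlockIdx BlockIdx ℂ} {M' : Matrix BlockIdx BlockIdx ℂ}
    {x : ℝ} (h : HasDerivAt M M' x) : HasDerivAt (fun y => (M y)ᵀ) M'ᵀ x :=
  hasDerivAt_matrix_iff.2 fun i j => hasDerivAt_matrix_iff.1 h j i

/-- A flow with coefficients in the symplectic Lie algebra is symplectic. -/
theorem transpose_mul_J_mul_of_hasDerivAt {A F : ℝ → Matrix BlockIdx BlockIdx ℂ}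
    (hA : ∀ x, (A x)ᵀ * J (Fin 2) ℂ = -(J (Fin 2) ℂ * A x)) (h0 : F 0 = 1)
    (hF : ∀ x, HasDerivAt F (A x * F x) x) (x : ℝ) :
    (F x)ᵀ * J (Fin 2) ℂ * F x = J (Fin 2) ℂ := by
  have hd : ∀ y, HasDerivAt (fun y => (F y)ᵀ * J (Fin 2) ℂ * F y) 0 y := fun y => by
    refine (((hasDerivAt_transpose (hF y)).mul_const _).mul (hF y)).congr_deriv ?_
    rw [transpose_mul, mul_assoc _ (A y)ᵀ, hA]
    noncomm_ring
  have := is_const_of_deriv_eq_zero (fun y => (hd y).differentiableAt)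
    (fun y => (hd y).deriv) x 0
  simpa [h0] using this

/-- For a symplectic F the matrix -JFᵀJ is the inverse. This closed form yields the adjoint equation
V' = -VA without differentiating an inverse, and it is polynomial in F, so analyticity is inherited.
-/
theorem hasDerivAt_symplectic_inv {A F : ℝ → Matrix BlockIdx BlockIdx ℂ}
    (hA : ∀ x, (A x)ᵀ * J (Fin 2) ℂ = -(J (Fin 2) ℂ * A x))
    (hF : ∀ x, HasDerivAt F (A x * F x) x) (x : ℝ) :
    HasDerivAt (fun y => -(J (Fin 2) ℂ * (F y)ᵀ * J (Fin 2) ℂ))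
      (-(-(J (Fin 2) ℂ * (F x)ᵀ * J (Fin 2) ℂ) * A x)) x := by
  refine ((((hasDerivAt_transpose (hF x)).const_mul _).mul_const _).neg).congr_deriv ?_
  rw [transpose_mul, mul_assoc, mul_assoc, hA]
  noncomm_ring

theorem mul_symplectic_inv {M : Matrix BlockIdx BlockIdx ℂ}
    (hM : Mᵀ * J (Fin 2) ℂ * M = J (Fin 2) ℂ) :
    M * -(J (Fin 2) ℂ * Mᵀ * J (Fin 2) ℂ) = 1 := by
  refine mul_eq_one_comm.1 ?_
  rw [neg_mul, mul_assoc, mul_assoc, ← mul_assoc Mᵀ, hM, J_squared, neg_neg]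

theorem symplectic_inv_one :
    -(J (Fin 2) ℂ * (1 : Matrix BlockIdx BlockIdx ℂ)ᵀ * J (Fin 2) ℂ) = 1 := by
  rw [transpose_one, mul_one, J_squared, neg_neg]

theorem xFlow_symplectic (hQ : IsDecayingGPSolution Q) (x : ℝ) (p : ℝ × ℂ) :
    (xFlow Q x p)ᵀ * J (Fin 2) ℂ * xFlow Q x p = J (Fin 2) ℂ :=
  transpose_mul_J_mul_of_hasDerivAt (F := fun y => xFlow Q y p)
    (fun y => laxX_transpose_mul_J hQ y p.1 p.2)
    (xFlow_zero p) (fun y => hasDerivAt_xFlow hQ y p) x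

theorem tFlow_symplectic (hQ : IsDecayingGPSolution Q) (t : ℝ) (lam : ℂ) :
    (tFlow Q t lam)ᵀ * J (Fin 2) ℂ * tFlow Q t lam = J (Fin 2) ℂ :=
  transpose_mul_J_mul_of_hasDerivAt (F := fun s => tFlow Q s lam)
    (fun s => laxT_transpose_mul_J hQ 0 s lam)
    (tFlow_zero lam) (fun s => hasDerivAt_tFlow hQ s lam) t

theorem differentiable_xFlow (hQ : IsDecayingGPSolution Q) (x t : ℝ) :
    Differentiable ℂ fun lam => xFlow Q x (t, lam) := by
  intro lam
  have hF : Continuous fun q : ℝ × ℂ => xFlow Q q.1 (t, q.2) :=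
    (continuous_xFlow hQ).comp (by fun_prop : Continuous fun q : ℝ × ℂ => (q.1, (t, q.2)))
  -- The coefficient is affine in λ, so its difference quotient is the constant -iσ.
  refine (hasDerivAt_fundamental_param (𝕜 := ℂ) (A := fun y mu => laxX Q y t mu)
    (D := fun _ _ => (-Complex.I) • laxSigma) (t := lam) hF continuous_const
    (fun mu => xFlow_zero _) (fun y mu => hasDerivAt_xFlow hQ y (t, mu)) ?_
    ?_ (fun y => hasDerivAt_symplectic_inv (F := fun y => xFlow Q y (t, lam))
      (fun y => laxX_transpose_mul_J hQ y t lam)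
      (fun y => hasDerivAt_xFlow hQ y (t, lam)) y)
    (fun y => mul_symplectic_inv (xFlow_symplectic hQ y (t, lam))) x).differentiableAt
  · intro y mu
    simp only [laxX]
    module
  · rw [xFlow_zero, symplectic_inv_one]

theorem differentiable_tFlow (hQ : IsDecayingGPSolution Q) (t : ℝ) :
    Differentiable ℂ fun lam => tFlow Q t lam := by
  intro lam
  have hU : Continuous fun q : ℝ × ℂ => laxU (Q 0 q.1) :=
    continuous_laxU (hQ.continuous_Q.comp (by fun_prop : Continuous fun q : ℝ × ℂ => ((0 : ℝ), q.1)))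
  -- The coefficient is quadratic in λ; the factor mu + lam comes from mu² - lam².
  refine (hasDerivAt_fundamental_param (𝕜 := ℂ) (A := fun y mu => laxT Q 0 y mu)
    (D := fun y mu => (-2 * Complex.I * (mu + lam)) • laxSigma + (2 : ℂ) • laxU (Q 0 y))
    (t := lam) (continuous_fundSol (continuous_laxT_zero hQ))
    (((continuous_const.mul (continuous_snd.add continuous_const)).smul continuous_const).add
      (hU.fun_const_smul _))
    (fun mu => tFlow_zero _) (fun y mu => hasDerivAt_tFlow hQ y mu) ?_
    ?_ (fun y => hasDerivAt_symplectic_inv (F := fun y => tFlow Q y lam)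
      (fun y => laxT_transpose_mul_J hQ 0 y lam)
      (fun y => hasDerivAt_tFlow hQ y lam) y)
    (fun y => mul_symplectic_inv (tFlow_symplectic hQ y lam)) t).differentiableAt
  · intro y mu
    simp only [laxT]
    module
  · rw [tFlow_zero, symplectic_inv_one]

/-- Compatibility of the two equations. The derivative in t is F ∫ V U_t F with V = F⁻¹, and by zero
curvature the integrand is the x-derivative of V T F, so the integral is evaluated by its end
points. -/
theorem hasDerivAt_xFlow_t (hQ : IsDecayingGPSolution Q) (x t : ℝ) (lam : ℂ) :
    HasDerivAt (fun s => xFlow Q x (s, lam))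
      (laxT Q x t lam * xFlow Q x (t, lam) - xFlow Q x (t, lam) * laxT Q 0 t lam) t := by
  have hF : Continuous fun q : ℝ × ℝ => xFlow Q q.1 (q.2, lam) :=
    (continuous_xFlow hQ).comp (by fun_prop : Continuous fun q : ℝ × ℝ => (q.1, (q.2, lam)))
  have hUt : Continuous fun q : ℝ × ℝ => laxU (matDt Q q.1 q.2) :=
    continuous_laxU (continuous_matDt hQ)
  set V : ℝ → Matrix BlockIdx BlockIdx ℂ :=
    fun y => -(J (Fin 2) ℂ * (xFlow Q y (t, lam))ᵀ * J (Fin 2) ℂ) with hV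
  have hV0 : V 0 = 1 := by rw [hV]; simp only [xFlow_zero, symplectic_inv_one]
  have hVx : ∀ y, HasDerivAt V (-(V y * laxX Q y t lam)) y := fun y =>
    hasDerivAt_symplectic_inv (F := fun y => xFlow Q y (t, lam))
      (fun y => laxX_transpose_mul_J hQ y t lam)
      (fun y => hasDerivAt_xFlow hQ y (t, lam)) y
  have hFV : ∀ y, xFlow Q y (t, lam) * V y = 1 :=
    fun y => mul_symplectic_inv (xFlow_symplectic hQ y (t, lam))
  have hpt : ∀ y s, Continuous fun τ : ℝ => laxU (matDt Q y (t + τ * (s - t))) := fun y s =>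
    hUt.comp (by fun_prop : Continuous fun τ : ℝ => (y, t + τ * (s - t)))
  -- `D` is the mean of U_t over the segment from t to s: the difference quotient of U, written so
  -- that it is jointly continuous also at s = t.
  have key := hasDerivAt_fundamental_param (𝕜 := ℝ) (A := fun y s => laxX Q y s lam)
    (D := fun y s => ∫ τ in (0 : ℝ)..1, laxU (matDt Q y (t + τ * (s - t)))) (t := t) (V := V) hF
    (intervalIntegral.continuous_parametric_intervalIntegral_of_continuous'
      (f := fun (q : ℝ × ℝ) τ => laxU (matDt Q q.1 (t + τ * (q.2 - t))))
      (hUt.comp (by fun_prop : Continuous fun z : (ℝ × ℝ) × ℝ =>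
        (z.1.1, t + z.2 * (z.1.2 - t)))) 0 1)
    (fun s => xFlow_zero _) (fun y s => hasDerivAt_xFlow hQ y (s, lam)) ?_ hV0 hVx hFV x
  · refine key.congr_deriv ?_
    have hd : ∀ y ∈ Set.uIcc 0 x, HasDerivAt
        (fun y => V y * laxT Q y t lam * xFlow Q y (t, lam))
        (V y * laxU (matDt Q y t) * xFlow Q y (t, lam)) y := by
      intro y _
      refine (((hVx y).mul (hasDerivAt_laxT_x hQ y t lam)).mul
        (hasDerivAt_xFlow hQ y (t, lam))).congr_deriv ?_
      simp only [Pi.mul_apply]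
      noncomm_ring
    have hVc : Continuous V := continuous_iff_continuousAt.2 fun y => (hVx y).continuousAt
    have hic : Continuous fun y => V y * laxU (matDt Q y t) * xFlow Q y (t, lam) :=
      (hVc.mul (hUt.comp (by fun_prop : Continuous fun y : ℝ => (y, t)))).mul
        (hF.comp (by fun_prop : Continuous fun y : ℝ => (y, t)))
    have hint := intervalIntegral.integral_eq_sub_of_hasDerivAt hd (hic.intervalIntegrable _ _)
    simp only [sub_self, mul_zero, add_zero, intervalIntegral.integral_const, sub_zero, one_smul]
    rw [hint, mul_sub, ← mul_assoc, ← mul_assoc, hFV, hV0, xFlow_zero]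
    simp
  · intro y s
    have hd : ∀ τ ∈ Set.uIcc (0 : ℝ) 1, HasDerivAt (fun τ : ℝ => laxU (Q y (t + τ * (s - t))))
        ((s - t) • laxU (matDt Q y (t + τ * (s - t)))) τ := by
      intro τ _
      have h1 : HasDerivAt (fun τ : ℝ => t + τ * (s - t)) (s - t) τ := by
        simpa using ((hasDerivAt_id τ).mul_const (s - t)).const_add t
      exact (hasDerivAt_laxU (hasDerivAt_Q_t hQ y _)).scomp τ h1
    have h2 := intervalIntegral.integral_eq_sub_of_hasDerivAt hd
      (((hpt y s).const_smul (s - t)).intervalIntegrable _ _)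
    rw [intervalIntegral.integral_smul] at h2
    rw [h2]
    simp [laxX]

/-- The fundamental solution of the Lax pair, equal to `1` at the origin. -/
def laxFlow (Q : ℝ → ℝ → Matrix (Fin 2) (Fin 2) ℂ) (x t : ℝ) (lam : ℂ) :
    Matrix BlockIdx BlockIdx ℂ :=
  xFlow Q x (t, lam) * tFlow Q t lam

theorem laxFlow_zero (lam : ℂ) : laxFlow Q 0 0 lam = 1 := by
  rw [laxFlow, xFlow_zero, tFlow_zero, one_mul]

theorem hasDerivAt_laxFlow_x (hQ : IsDecayingGPSolution Q) (x t : ℝ) (lam : ℂ) (i j : BlockIdx) :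
    HasDerivAt (fun y => laxFlow Q y t lam i j) ((laxX Q x t lam * laxFlow Q x t lam) i j) x := by
  refine hasDerivAt_matrix_iff.1 ?_ i j
  refine ((hasDerivAt_xFlow hQ x (t, lam)).mul_const (tFlow Q t lam)).congr_deriv ?_
  rw [laxFlow, mul_assoc]

/-- The boundary term at x = 0 in the t-derivative of `xFlow` is cancelled by the equation for
`tFlow`. -/
theorem hasDerivAt_laxFlow_t (hQ : IsDecayingGPSolution Q) (x t : ℝ) (lam : ℂ) (i j : BlockIdx) :
    HasDerivAt (fun s => laxFlow Q x s lam i j) ((laxT Q x t lam * laxFlow Q x t lam) i j) t := by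
  refine hasDerivAt_matrix_iff.1 ?_ i j
  refine ((hasDerivAt_xFlow_t hQ x t lam).mul (hasDerivAt_tFlow hQ t lam)).congr_deriv ?_
  rw [laxFlow]
  noncomm_ring

theorem differentiable_laxFlow (hQ : IsDecayingGPSolution Q) (x t : ℝ) (i j : BlockIdx) :
    Differentiable ℂ fun lam => laxFlow Q x t lam i j := fun lam =>
  (hasDerivAt_matrix_iff.1 ((differentiable_xFlow hQ x t).mul
    (differentiable_tFlow hQ t) lam).hasDerivAt i j).differentiableAt

theorem laxFlow_symplectic (hQ : IsDecayingGPSolution Q) (x t : ℝ) (lam : ℂ) :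
    (laxFlow Q x t lam)ᵀ * J (Fin 2) ℂ * laxFlow Q x t lam = J (Fin 2) ℂ := by
  rw [laxFlow, transpose_mul]
  calc _ = (tFlow Q t lam)ᵀ * ((xFlow Q x (t, lam))ᵀ * J (Fin 2) ℂ * xFlow Q x (t, lam))
        * tFlow Q t lam := by noncomm_ring
    _ = _ := by rw [xFlow_symplectic hQ, tFlow_symplectic hQ]

end LaxFlow

/-! ### Energy estimates for the dressed x-equation. -/

noncomputable section Dissipation

open Matrix

/-- Formally (√u)' = u'/(2√u) ≤ q. Since u may vanish, the argument is run with u + δ and then δ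
tends to 0. -/
theorem sqrt_le_sqrt_add_integral {u u' q : ℝ → ℝ} (hu0 : ∀ y, 0 ≤ u y)
    (hu : ∀ y, HasDerivAt u (u' y) y) (hq : Continuous q) (hq0 : ∀ y, 0 ≤ q y)
    (hle : ∀ y, u' y ≤ 2 * q y * √(u y)) {a b : ℝ} (hab : a ≤ b) :
    √(u b) ≤ √(u a) + ∫ y in a..b, q y := by
  have main : ∀ δ : ℝ, 0 < δ → √(u b) ≤ √(u a + δ) + ∫ y in a..b, q y := by
    intro δ hδ
    have hpos : ∀ y, 0 < u y + δ := fun y => by linarith [hu0 y]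
    have hd : ∀ y, HasDerivAt (fun y => √(u y + δ) - ∫ z in a..y, q z)
        (u' y / (2 * √(u y + δ)) - q y) y := fun y =>
      (((hu y).add_const δ).sqrt (hpos y).ne').sub
        (intervalIntegral.integral_hasDerivAt_right (hq.intervalIntegrable _ _)
          (hq.stronglyMeasurableAtFilter _ _) hq.continuousAt)
    have hanti : Antitone fun y => √(u y + δ) - ∫ z in a..y, q z := by
      refine antitone_of_deriv_nonpos (fun y => (hd y).differentiableAt) fun y => ?_
      rw [(hd y).deriv, sub_nonpos, div_le_iff₀ (by have := Real.sqrt_pos.2 (hpos y); positivity)]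
      have h1 : √(u y) ≤ √(u y + δ) := Real.sqrt_le_sqrt (by linarith)
      have h2 := mul_le_mul_of_nonneg_left h1 (hq0 y)
      linarith [hle y]
    have h := hanti hab
    simp only [intervalIntegral.integral_same, sub_zero] at h
    have h1 : √(u b) ≤ √(u b + δ) := Real.sqrt_le_sqrt (by linarith)
    linarith
  have hlim : Filter.Tendsto (fun δ : ℝ => √(u a + δ) + ∫ y in a..b, q y) (𝓝[>] 0)
      (𝓝 (√(u a + 0) + ∫ y in a..b, q y)) :=
    (Continuous.tendsto (by fun_prop) 0).mono_left nhdsWithin_le_nhds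
  rw [add_zero] at hlim
  exact ge_of_tendsto hlim (Filter.eventually_of_mem self_mem_nhdsWithin fun δ hδ => main δ hδ)

/-- The Euclidean norm on `ℂ⁴`. -/
def euclNorm (v : BlockIdx → ℂ) : ℝ := √(∑ i, ‖v i‖ ^ 2)

theorem norm_le_euclNorm (v : BlockIdx → ℂ) (i : BlockIdx) : ‖v i‖ ≤ euclNorm v :=
  Real.le_sqrt_of_sq_le (Finset.single_le_sum (f := fun i => ‖v i‖ ^ 2)
    (fun _ _ => sq_nonneg _) (Finset.mem_univ i))

theorem continuous_euclNorm : Continuous euclNorm := by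
  unfold euclNorm
  fun_prop

theorem euclNorm_zero : euclNorm 0 = 0 := by simp [euclNorm]

/-- The growth of the solutions of a linear system with dissipative coefficients. -/
theorem euclNorm_le_of_dissipative {M : ℝ → Matrix BlockIdx BlockIdx ℂ}
    {v f : ℝ → BlockIdx → ℂ} {q : ℝ → ℝ}
    (hv : ∀ y i, HasDerivAt (fun y => v y i) ((M y *ᵥ v y) i + f y i) y)
    (hM : ∀ y w, (star w ⬝ᵥ (M y *ᵥ w)).re ≤ 0)
    (hq : Continuous q) (hf : ∀ y, ∑ i, ‖f y i‖ ≤ q y) {a b : ℝ} (hab : a ≤ b) :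
    euclNorm (v b) ≤ euclNorm (v a) + ∫ y in a..b, q y := by
  have hd : ∀ y, HasDerivAt (fun y => ∑ i, ‖v y i‖ ^ 2)
      (∑ i, 2 * inner ℝ (v y i) ((M y *ᵥ v y) i + f y i)) y := fun y =>
    HasDerivAt.fun_sum fun i _ => (hv y i).norm_sq
  refine sqrt_le_sqrt_add_integral (fun y => Finset.sum_nonneg fun _ _ => sq_nonneg _) hd hq
    (fun y => (Finset.sum_nonneg fun _ _ => norm_nonneg _).trans (hf y)) (fun y => ?_) hab
  have h1 : ∑ i, inner ℝ (v y i) ((M y *ᵥ v y) i) ≤ 0 := by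
    refine le_trans (le_of_eq ?_) (hM y (v y))
    simp only [dotProduct, Complex.re_sum, Pi.star_apply, RCLike.star_def, Complex.inner]
    exact Finset.sum_congr rfl fun i _ => by ring_nf
  have h2 : ∑ i, inner ℝ (v y i) (f y i) ≤ q y * euclNorm (v y) := by
    calc ∑ i, inner ℝ (v y i) (f y i) ≤ ∑ i, euclNorm (v y) * ‖f y i‖ :=
          Finset.sum_le_sum fun i _ => (real_inner_le_norm _ _).trans
            (mul_le_mul_of_nonneg_right (norm_le_euclNorm _ i) (norm_nonneg _))
      _ = (∑ i, ‖f y i‖) * euclNorm (v y) := by rw [← Finset.mul_sum, mul_comm]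
      _ ≤ _ := mul_le_mul_of_nonneg_right (hf y) (Real.sqrt_nonneg _)
  simp only [inner_add_right, mul_add, Finset.sum_add_distrib, ← Finset.mul_sum]
  rw [mul_assoc]
  change _ ≤ 2 * (q y * euclNorm (v y))
  linarith

/-- U is skew-Hermitian for every q, so the potential does not contribute to the growth of the
Euclidean norm. -/
theorem re_star_dotProduct_laxU (q : Matrix (Fin 2) (Fin 2) ℂ) (w : BlockIdx → ℂ) :
    (star w ⬝ᵥ (laxU q *ᵥ w)).re = 0 := by
  simp [dotProduct, mulVec, laxU, Fin.sum_univ_two]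
  ring

/-- The matrix 1 - εσ is 0 on one block and 2 on the other, and Re(iλ) = -Im λ: the form equals -2
Im λ times the squared norm of the block where σ = -ε. -/
theorem re_star_dotProduct_phase {ε : ℝ} (hε : ε = 1 ∨ ε = -1) {lam : ℂ} (hlam : 0 ≤ lam.im)
    (w : BlockIdx → ℂ) :
    (star w ⬝ᵥ (((Complex.I * lam) • (1 - (ε : ℂ) • laxSigma)) *ᵥ w)).re ≤ 0 := by
  have h0 := mul_nonneg hlam (Complex.normSq_nonneg (w (Sum.inl 0)))
  have h1 := mul_nonneg hlam (Complex.normSq_nonneg (w (Sum.inl 1)))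
  have h2 := mul_nonneg hlam (Complex.normSq_nonneg (w (Sum.inr 0)))
  have h3 := mul_nonneg hlam (Complex.normSq_nonneg (w (Sum.inr 1)))
  simp only [Complex.normSq_apply] at h0 h1 h2 h3
  rcases hε with rfl | rfl
  · simp [dotProduct, mulVec, laxSigma, Fin.sum_univ_two, one_apply, Matrix.smul_apply,
      Matrix.sub_apply]
    nlinarith
  · simp [dotProduct, mulVec, laxSigma, Fin.sum_univ_two, one_apply, Matrix.smul_apply]
    nlinarith

/-- The coefficients of the `x`-part of the Lax pair, after a reflection `x = ε y` and after
multiplication of the solutions with `exp (i ε θ)`. -/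
def dressedCoeff (Q : ℝ → ℝ → Matrix (Fin 2) (Fin 2) ℂ) (ε t : ℝ) (lam : ℂ) (y : ℝ) :
    Matrix BlockIdx BlockIdx ℂ :=
  (Complex.I * lam) • (1 - (ε : ℂ) • laxSigma) + (ε : ℂ) • laxU (Q (ε * y) t)

/-- A vector function of `x`, multiplied with `exp (i ε θ)` and reflected by `x = ε y`. -/
def dressed (ε t : ℝ) (lam : ℂ) (w : ℝ → BlockIdx → ℂ) (y : ℝ) : BlockIdx → ℂ :=
  Complex.exp (Complex.I * ε * gpTheta (ε * y) t lam) • w (ε * y)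

variable {Q : ℝ → ℝ → Matrix (Fin 2) (Fin 2) ℂ} {ε : ℝ}

theorem re_star_dotProduct_dressedCoeff (hε : ε = 1 ∨ ε = -1) {lam : ℂ} (hlam : 0 ≤ lam.im)
    (t y : ℝ) (w : BlockIdx → ℂ) :
    (star w ⬝ᵥ (dressedCoeff Q ε t lam y *ᵥ w)).re ≤ 0 := by
  rw [dressedCoeff, add_mulVec, dotProduct_add, Complex.add_re, smul_mulVec, smul_mulVec,
    dotProduct_smul (ε : ℂ), smul_eq_mul, Complex.re_ofReal_mul, re_star_dotProduct_laxU, mul_zero,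
    add_zero, ← smul_mulVec]
  exact re_star_dotProduct_phase hε hlam w

theorem hasDerivAt_dressed (hε : ε = 1 ∨ ε = -1) {t : ℝ} {lam : ℂ} {w : ℝ → BlockIdx → ℂ}
    (hw : ∀ x i, HasDerivAt (fun y => w y i) ((laxX Q x t lam *ᵥ w x) i) x) (y : ℝ)
    (i : BlockIdx) :
    HasDerivAt (fun y => dressed ε t lam w y i)
      ((dressedCoeff Q ε t lam y *ᵥ dressed ε t lam w y) i) y := by
  have hlin : HasDerivAt (fun y : ℝ => ε * y) ε y := by simpa using (hasDerivAt_id y).const_mul ε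
  have hε2 : (ε : ℂ) * ε = 1 := by rcases hε with rfl | rfl <;> simp
  have hθ : HasDerivAt (fun y : ℝ => Complex.I * ε * gpTheta (ε * y) t lam)
      (Complex.I * lam) y := by
    have h1 : HasDerivAt (fun y : ℝ => ((ε * y : ℝ) : ℂ)) (ε : ℂ) y := hlin.ofReal_comp
    have h2 := ((h1.const_mul lam).add_const (2 * lam ^ 2 * (t : ℂ))).const_mul (Complex.I * ε)
    refine h2.congr_deriv ?_
    linear_combination Complex.I * lam * hε2
  have h := hθ.cexp.mul ((hw (ε * y) i).scomp y hlin)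
  refine h.congr_deriv ?_
  simp only [dressed, dressedCoeff, laxX, mulVec_smul, add_mulVec, smul_mulVec, sub_mulVec,
    one_mulVec, Pi.smul_apply, Pi.add_apply, Pi.sub_apply, smul_eq_mul, Complex.real_smul,
    Function.comp]
  ring

/-- The dissipative estimate without source. It serves both the Cauchy property of the
approximations and the uniqueness of Jost solutions. -/
theorem euclNorm_dressed_antitone (hε : ε = 1 ∨ ε = -1) {t : ℝ} {lam : ℂ} (hlam : 0 ≤ lam.im)
    {w : ℝ → BlockIdx → ℂ}
    (hw : ∀ x i, HasDerivAt (fun y => w y i) ((laxX Q x t lam *ᵥ w x) i) x) :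
    Antitone fun y => euclNorm (dressed ε t lam w y) := by
  intro a b hab
  have h := euclNorm_le_of_dissipative (f := 0) (q := 0) (v := dressed ε t lam w)
    (M := dressedCoeff Q ε t lam)
    (fun y i => by simpa using hasDerivAt_dressed hε hw y i)
    (fun y w => re_star_dotProduct_dressedCoeff hε hlam t y w) continuous_const (by simp) hab
  simpa using h

/-- A bound for the action of `U` on vectors with entries at most `1`. -/
def potentialSize (Q : ℝ → ℝ → Matrix (Fin 2) (Fin 2) ℂ) (ε t y : ℝ) : ℝ :=
  2 * ∑ i, ∑ j, ‖Q (ε * y) t i j‖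

theorem continuous_potentialSize (hQ : IsDecayingGPSolution Q) (ε t : ℝ) :
    Continuous (potentialSize Q ε t) := by
  have h : ∀ i j, Continuous fun y => Q (ε * y) t i j := fun i j =>
    (hQ.contDiff_x i j t).continuous.comp (continuous_const.mul continuous_id)
  exact continuous_const.mul (continuous_finsetSum _ fun i _ => continuous_finsetSum _ fun j _ =>
    (h i j).norm)

theorem potentialSize_nonneg (ε t y : ℝ) : 0 ≤ potentialSize Q ε t y := by
  unfold potentialSize; positivity

theorem integrable_potentialSize (hQ : IsDecayingGPSolution Q) (hε : ε = 1 ∨ ε = -1) (t : ℝ) :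
    MeasureTheory.Integrable (potentialSize Q ε t) := by
  have hε0 : ε ≠ 0 := by rcases hε with rfl | rfl <;> norm_num
  refine (MeasureTheory.integrable_finsetSum _ fun i _ =>
    MeasureTheory.integrable_finsetSum _ fun j _ => ?_).const_mul 2
  exact ((hQ.integrable i j t).comp_mul_left' hε0).norm

theorem sum_norm_laxU_mulVec_le (q : Matrix (Fin 2) (Fin 2) ℂ) {e : BlockIdx → ℂ}
    (he : ∀ i, ‖e i‖ ≤ 1) : ∑ i, ‖(laxU q *ᵥ e) i‖ ≤ 2 * ∑ i, ∑ j, ‖q i j‖ := by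
  calc ∑ i, ‖(laxU q *ᵥ e) i‖ ≤ ∑ i, ∑ j, ‖laxU q i j‖ := by
        refine Finset.sum_le_sum fun i _ => ?_
        rw [mulVec, dotProduct]
        refine (norm_sum_le _ _).trans (Finset.sum_le_sum fun j _ => ?_)
        rw [norm_mul]
        exact mul_le_of_le_one_right (norm_nonneg _) (he j)
    _ = _ := by
        simp [laxU, Fin.sum_univ_two]
        ring

/-- The phase matrix annihilates e, so the deviation from e solves the same dissipative system with
the source εUe, which is integrable and independent of λ. -/
theorem euclNorm_dressed_sub_le (hQ : IsDecayingGPSolution Q) (hε : ε = 1 ∨ ε = -1) {t : ℝ}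
    {lam : ℂ} (hlam : 0 ≤ lam.im) {w : ℝ → BlockIdx → ℂ}
    (hw : ∀ x i, HasDerivAt (fun y => w y i) ((laxX Q x t lam *ᵥ w x) i) x)
    {e : BlockIdx → ℂ} (he : laxSigma *ᵥ e = (ε : ℂ) • e) (he1 : ∀ i, ‖e i‖ ≤ 1)
    {a b : ℝ} (hab : a ≤ b) :
    euclNorm (dressed ε t lam w b - e) ≤
      euclNorm (dressed ε t lam w a - e) + ∫ y in a..b, potentialSize Q ε t y := by
  have hε2 : (ε : ℂ) * ε = 1 := by rcases hε with rfl | rfl <;> simp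
  have hεn : ‖(ε : ℂ)‖ = 1 := by rcases hε with rfl | rfl <;> simp
  refine euclNorm_le_of_dissipative (v := fun y => dressed ε t lam w y - e)
    (M := dressedCoeff Q ε t lam) (f := fun y => (ε : ℂ) • (laxU (Q (ε * y) t) *ᵥ e))
    (fun y i => ?_) (fun y w => re_star_dotProduct_dressedCoeff hε hlam t y w)
    (continuous_potentialSize hQ ε t) (fun y => ?_) hab
  · refine ((hasDerivAt_dressed hε hw y i).sub_const (e i)).congr_deriv ?_
    have : dressedCoeff Q ε t lam y *ᵥ e = (ε : ℂ) • (laxU (Q (ε * y) t) *ᵥ e) := by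
      rw [dressedCoeff, add_mulVec, smul_mulVec, smul_mulVec, sub_mulVec, smul_mulVec, he,
        one_mulVec, smul_smul, hε2, one_smul, sub_self, smul_zero, zero_add]
    rw [mulVec_sub, this, Pi.sub_apply, sub_add_cancel]
  · simp only [Pi.smul_apply, smul_eq_mul, norm_mul, hεn, one_mul]
    exact sum_norm_laxU_mulVec_le _ he1

end Dissipation

/-! ### Jost solutions at t = 0: existence and analyticity. -/

noncomputable section JostCoefficients

open Matrix

variable {Q : ℝ → ℝ → Matrix (Fin 2) (Fin 2) ℂ} {ε : ℝ} {E : Matrix BlockIdx (Fin 2) ℂ}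

theorem hasDerivAt_laxFlow_mul_x (hQ : IsDecayingGPSolution Q) (x t : ℝ) (lam : ℂ)
    (C : Matrix BlockIdx (Fin 2) ℂ) (i : BlockIdx) (j : Fin 2) :
    HasDerivAt (fun y => (laxFlow Q y t lam * C) i j)
      ((laxX Q x t lam * (laxFlow Q x t lam * C)) i j) x := by
  rw [← Matrix.mul_assoc]
  change HasDerivAt (fun y => ∑ k, laxFlow Q y t lam i k * C k j)
    (∑ k, (laxX Q x t lam * laxFlow Q x t lam) i k * C k j) x
  exact HasDerivAt.fun_sum fun k _ => (hasDerivAt_laxFlow_x hQ x t lam i k).mul_const _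

theorem hasDerivAt_laxFlow_mul_t (hQ : IsDecayingGPSolution Q) (x t : ℝ) (lam : ℂ)
    (C : Matrix BlockIdx (Fin 2) ℂ) (i : BlockIdx) (j : Fin 2) :
    HasDerivAt (fun s => (laxFlow Q x s lam * C) i j)
      ((laxT Q x t lam * (laxFlow Q x t lam * C)) i j) t := by
  rw [← Matrix.mul_assoc]
  change HasDerivAt (fun s => ∑ k, laxFlow Q x s lam i k * C k j)
    (∑ k, (laxT Q x t lam * laxFlow Q x t lam) i k * C k j) t
  exact HasDerivAt.fun_sum fun k _ => (hasDerivAt_laxFlow_t hQ x t lam i k).mul_const _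

/-- The value at the origin of the solution of the Lax pair which is normalized at the point
`x = -ε n` instead of `∓∞`. -/
def jostApprox (Q : ℝ → ℝ → Matrix (Fin 2) (Fin 2) ℂ) (ε : ℝ) (E : Matrix BlockIdx (Fin 2) ℂ)
    (n : ℕ) (lam : ℂ) : Matrix BlockIdx (Fin 2) ℂ :=
  Complex.exp (Complex.I * lam * n) •
    (-(J (Fin 2) ℂ * (laxFlow Q (ε * -n) 0 lam)ᵀ * J (Fin 2) ℂ) * E)

/-- The value at the origin of the Jost solution. -/
def jostCoeff (Q : ℝ → ℝ → Matrix (Fin 2) (Fin 2) ℂ) (ε : ℝ) (E : Matrix BlockIdx (Fin 2) ℂ)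
    (lam : ℂ) : Matrix BlockIdx (Fin 2) ℂ :=
  Matrix.of fun i j => Filter.atTop.limUnder fun n : ℕ => jostApprox Q ε E n lam i j

/-- The columns of the solution of the Lax pair at `t` with value `C` at the origin, dressed. -/
def dressedFlow (Q : ℝ → ℝ → Matrix (Fin 2) (Fin 2) ℂ) (ε t : ℝ) (lam : ℂ)
    (C : Matrix BlockIdx (Fin 2) ℂ) (j : Fin 2) : ℝ → BlockIdx → ℂ :=
  dressed ε t lam fun x i => (laxFlow Q x t lam * C) i j

theorem dressedFlow_eq (t : ℝ) (lam : ℂ) (C : Matrix BlockIdx (Fin 2) ℂ) (j : Fin 2) (y : ℝ) :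
    dressedFlow Q ε t lam C j y = fun i => (Complex.exp (Complex.I * ε *
      gpTheta (ε * y) t lam) • (laxFlow Q (ε * y) t lam * C)) i j := rfl

theorem dressedFlow_zero (lam : ℂ) (C : Matrix BlockIdx (Fin 2) ℂ) (j : Fin 2) :
    dressedFlow Q ε 0 lam C j 0 = fun i => C i j := by
  rw [dressedFlow_eq]
  simp [gpTheta, laxFlow_zero]

theorem dressedFlow_sub (t : ℝ) (lam : ℂ) (C C' : Matrix BlockIdx (Fin 2) ℂ) (j : Fin 2) (y : ℝ) :
    dressedFlow Q ε t lam (C - C') j y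
      = dressedFlow Q ε t lam C j y - dressedFlow Q ε t lam C' j y := by
  simp only [dressedFlow_eq, Matrix.mul_sub, smul_sub]
  rfl

/-- The inverse flow in `jostApprox` undoes the flow to the normalization point, and its exponential
cancels the dressing factor there, because ε² = 1. -/
theorem dressedFlow_jostApprox (hQ : IsDecayingGPSolution Q) (hε : ε = 1 ∨ ε = -1) (n : ℕ)
    (lam : ℂ) (j : Fin 2) :
    dressedFlow Q ε 0 lam (jostApprox Q ε E n lam) j (-n) = fun i => E i j := by
  have hε2 : (ε : ℂ) * ε = 1 := by rcases hε with rfl | rfl <;> simp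
  rw [dressedFlow_eq, jostApprox, Matrix.mul_smul, ← Matrix.mul_assoc,
    mul_symplectic_inv (laxFlow_symplectic hQ _ _ _), Matrix.one_mul, smul_smul, ← Complex.exp_add]
  have : Complex.I * ε * gpTheta (ε * -n) 0 lam + Complex.I * lam * n = 0 := by
    simp only [gpTheta]
    push_cast
    linear_combination (-Complex.I * lam * n) * hε2
  rw [this, Complex.exp_zero, one_smul]

theorem differentiable_jostApprox (hQ : IsDecayingGPSolution Q) (n : ℕ) (i : BlockIdx)
    (j : Fin 2) : Differentiable ℂ fun lam => jostApprox Q ε E n lam i j := by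
  have h := differentiable_laxFlow hQ (ε * -n) 0
  simp only [jostApprox, Matrix.smul_apply, smul_eq_mul, mul_apply, Matrix.neg_apply,
    transpose_apply]
  fun_prop

/-- The tail of the integral of the potential. -/
def potentialTail (Q : ℝ → ℝ → Matrix (Fin 2) (Fin 2) ℂ) (ε y : ℝ) : ℝ :=
  ∫ z in Set.Iic y, potentialSize Q ε 0 z

theorem tendsto_potentialTail :
    Filter.Tendsto (potentialTail Q ε) Filter.atBot (𝓝 0) :=
  MeasureTheory.tendsto_integral_Iic_zero Filter.tendsto_id

theorem intervalIntegral_le_potentialTail (hQ : IsDecayingGPSolution Q) (hε : ε = 1 ∨ ε = -1)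
    {a b : ℝ} (hab : a ≤ b) : ∫ y in a..b, potentialSize Q ε 0 y ≤ potentialTail Q ε b := by
  rw [intervalIntegral.integral_of_le hab]
  exact MeasureTheory.setIntegral_mono_set (integrable_potentialSize hQ hε 0).integrableOn
    (Filter.Eventually.of_forall fun y => potentialSize_nonneg _ _ _)
    (Set.Ioc_subset_Iic_self).eventuallyLE

/-- The columns `e` of the normalization `E`: `σ e = ε e`, with entries at most `1`. -/
structure IsNormalization (ε : ℝ) (E : Matrix BlockIdx (Fin 2) ℂ) : Prop where
  sign : ε = 1 ∨ ε = -1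
  sigma : ∀ j, laxSigma *ᵥ (fun i => E i j) = (ε : ℂ) • fun i => E i j
  le_one : ∀ i j, ‖E i j‖ ≤ 1

variable {lam : ℂ}

theorem euclNorm_dressedFlow_jostApprox_sub_le (hQ : IsDecayingGPSolution Q)
    (hE : IsNormalization ε E) (hlam : 0 ≤ lam.im) (n : ℕ) (j : Fin 2) {y : ℝ} (hy : -n ≤ y) :
    euclNorm (dressedFlow Q ε 0 lam (jostApprox Q ε E n lam) j y - fun i => E i j)
      ≤ potentialTail Q ε y := by
  have h := euclNorm_dressed_sub_le hQ hE.sign hlam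
    (fun x i => hasDerivAt_laxFlow_mul_x hQ x 0 lam (jostApprox Q ε E n lam) i j)
    (hE.sigma j) (fun i => hE.le_one i j) hy
  refine h.trans ?_
  rw [← dressedFlow, dressedFlow_jostApprox hQ hE.sign, sub_self, euclNorm_zero, zero_add]
  exact intervalIntegral_le_potentialTail hQ hE.sign hy

/-- The dressed difference does not grow from y = -n to y = 0. At y = -n approximation n equals E
exactly, and approximation m has deviated from E by at most the tail. The bound does not involve λ,
hence the convergence is uniform on the closed half plane. -/
theorem norm_jostApprox_sub_le (hQ : IsDecayingGPSolution Q) (hE : IsNormalization ε E)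
    (hlam : 0 ≤ lam.im) {n m : ℕ} (hnm : n ≤ m) (i : BlockIdx) (j : Fin 2) :
    ‖jostApprox Q ε E m lam i j - jostApprox Q ε E n lam i j‖ ≤ potentialTail Q ε (-n) := by
  have h := euclNorm_dressed_antitone hE.sign hlam
    (fun x i => hasDerivAt_laxFlow_mul_x hQ x 0 lam
      (jostApprox Q ε E m lam - jostApprox Q ε E n lam) i j)
    (show (-n : ℝ) ≤ 0 by simp)
  change euclNorm (dressedFlow Q ε 0 lam _ j 0) ≤ euclNorm (dressedFlow Q ε 0 lam _ j (-n)) at h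
  rw [dressedFlow_zero, dressedFlow_sub, dressedFlow_jostApprox hQ hE.sign n] at h
  refine (norm_le_euclNorm _ i).trans (h.trans
    (euclNorm_dressedFlow_jostApprox_sub_le hQ hE hlam m j ?_))
  exact neg_le_neg (by exact_mod_cast hnm)

theorem tendsto_potentialTail_nat :
    Filter.Tendsto (fun n : ℕ => potentialTail Q ε (-n)) Filter.atTop (𝓝 0) :=
  (tendsto_potentialTail).comp
    (Filter.tendsto_neg_atTop_atBot.comp tendsto_natCast_atTop_atTop)

theorem tendsto_jostApprox (hQ : IsDecayingGPSolution Q) (hE : IsNormalization ε E)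
    (hlam : 0 ≤ lam.im) (i : BlockIdx) (j : Fin 2) :
    Filter.Tendsto (fun n => jostApprox Q ε E n lam i j) Filter.atTop
      (𝓝 (jostCoeff Q ε E lam i j)) := by
  have h : CauchySeq fun n => jostApprox Q ε E n lam i j := by
    refine cauchySeq_of_le_tendsto_0' (fun n : ℕ => potentialTail Q ε (-n)) (fun n m hnm => ?_)
      (tendsto_potentialTail_nat)
    rw [dist_comm, dist_eq_norm]
    exact norm_jostApprox_sub_le hQ hE hlam hnm i j
  exact h.tendsto_limUnder

theorem norm_jostCoeff_sub_le (hQ : IsDecayingGPSolution Q) (hE : IsNormalization ε E)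
    (hlam : 0 ≤ lam.im) (n : ℕ) (i : BlockIdx) (j : Fin 2) :
    ‖jostCoeff Q ε E lam i j - jostApprox Q ε E n lam i j‖ ≤ potentialTail Q ε (-n) :=
  le_of_tendsto ((tendsto_jostApprox hQ hE hlam i j).sub_const _).norm
    ((Filter.eventually_ge_atTop n).mono fun _ hm => norm_jostApprox_sub_le hQ hE hlam hm i j)

/-- The Jost solutions are analytic in the open half plane. -/
theorem differentiableOn_jostCoeff (hQ : IsDecayingGPSolution Q) (hE : IsNormalization ε E)
    (i : BlockIdx) (j : Fin 2) :
    DifferentiableOn ℂ (fun lam => jostCoeff Q ε E lam i j) {lam | 0 < lam.im} := by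
  have hu : TendstoUniformlyOn (fun n lam => jostApprox Q ε E n lam i j)
      (fun lam => jostCoeff Q ε E lam i j) Filter.atTop {lam | 0 < lam.im} := by
    rw [Metric.tendstoUniformlyOn_iff]
    intro δ hδ
    filter_upwards [(tendsto_potentialTail_nat).eventually_lt_const hδ] with n hn
    intro lam hlam
    rw [dist_eq_norm]
    exact (norm_jostCoeff_sub_le hQ hE (le_of_lt hlam) n i j).trans_lt hn
  exact hu.tendstoLocallyUniformlyOn.differentiableOn
    (Filter.Eventually.of_forall fun n => (differentiable_jostApprox hQ n i j).differentiableOn)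
    (isOpen_lt continuous_const Complex.continuous_im)

theorem tendsto_dressedFlow (hQ : IsDecayingGPSolution Q) (hE : IsNormalization ε E)
    (hlam : 0 ≤ lam.im) (j : Fin 2) :
    Filter.Tendsto (dressedFlow Q ε 0 lam (jostCoeff Q ε E lam) j) Filter.atBot
      (𝓝 fun i => E i j) := by
  -- At fixed y the tail bound holds for every approximation with -n ≤ y, so it survives the limit
  -- in n.
  have hle : ∀ y, euclNorm (dressedFlow Q ε 0 lam (jostCoeff Q ε E lam) j y - fun i => E i j)
      ≤ potentialTail Q ε y := by
    intro y
    have hlim : Filter.Tendsto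
        (fun n => dressedFlow Q ε 0 lam (jostApprox Q ε E n lam) j y - fun i => E i j)
        Filter.atTop
        (𝓝 (dressedFlow Q ε 0 lam (jostCoeff Q ε E lam) j y - fun i => E i j)) := by
      refine Filter.Tendsto.sub_const (tendsto_pi_nhds.2 fun i => ?_) _
      simp only [dressedFlow_eq, Matrix.smul_apply, mul_apply]
      exact (tendsto_finsetSum _ fun k _ =>
        (tendsto_jostApprox hQ hE hlam k j).const_mul _).const_smul _
    refine le_of_tendsto ((continuous_euclNorm.tendsto _).comp hlim) ?_
    obtain ⟨N, hN⟩ := exists_nat_ge (-y)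
    filter_upwards [Filter.eventually_ge_atTop N] with n hn
    refine euclNorm_dressedFlow_jostApprox_sub_le hQ hE hlam n j ?_
    have : (N : ℝ) ≤ n := by exact_mod_cast hn
    linarith
  refine tendsto_pi_nhds.2 fun i => tendsto_iff_norm_sub_tendsto_zero.2 ?_
  exact squeeze_zero (fun _ => norm_nonneg _)
    (fun y => (norm_le_euclNorm (dressedFlow Q ε 0 lam (jostCoeff Q ε E lam) j y - fun i => E i j)
      i).trans (hle y)) (tendsto_potentialTail)

end JostCoefficients

/-! ### Jost solutions for all t: normalization and uniqueness. -/

noncomputable section JostSolutions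

attribute [local instance] Matrix.linftyOpNormedRing Matrix.linftyOpNormedAlgebra

open Matrix

/-- Grönwall's inequality on `[0, 1]` with a source term. -/
theorem norm_le_mul_exp_of_source {V : Type*} [NormedAddCommGroup V] [NormedSpace ℝ V]
    [CompleteSpace V] {h h' b : ℝ → V} {K : ℝ} (hK : 0 < K)
    (hh : ∀ s, HasDerivAt h (h' s) s) (hb : Continuous b)
    (hle : ∀ s ∈ Set.Icc (0 : ℝ) 1, ‖h' s - b s‖ ≤ K * ‖h s‖) :
    ‖h 1‖ ≤ (‖h 0‖ + ∫ s in (0 : ℝ)..1, ‖b s‖) * Real.exp K := by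
  set η := ∫ s in (0 : ℝ)..1, ‖b s‖ with hη
  have hη0 : 0 ≤ η := intervalIntegral.integral_nonneg zero_le_one fun _ _ => norm_nonneg _
  set n : ℝ → V := fun s => ∫ τ in (0 : ℝ)..s, b τ with hn
  have hnd : ∀ s, HasDerivAt n (b s) s := fun s =>
    intervalIntegral.integral_hasDerivAt_right (hb.intervalIntegrable _ _)
      (hb.stronglyMeasurableAtFilter _ _) hb.continuousAt
  have hnle : ∀ s ∈ Set.Icc (0 : ℝ) 1, ‖n s‖ ≤ η := by
    intro s hs
    refine (intervalIntegral.norm_integral_le_integral_norm hs.1).trans ?_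
    exact intervalIntegral.integral_mono_interval le_rfl hs.1 hs.2
      (Filter.Eventually.of_forall fun _ => norm_nonneg _) (hb.norm.intervalIntegrable _ _)
  have hd : ∀ s, HasDerivAt (fun s => h s - n s) (h' s - b s) s := fun s => (hh s).sub (hnd s)
  -- Subtracting the primitive of the source leaves a function to which the standard Grönwall
  -- inequality applies, with constant source Kη.
  have key := norm_le_gronwallBound_of_norm_deriv_right_le (f := fun s => h s - n s)
    (f' := fun s => h' s - b s) (δ := ‖h 0‖) (K := K) (ε := K * η) (a := 0) (b := 1)
    (fun s _ => (hd s).continuousAt.continuousWithinAt) (fun s _ => (hd s).hasDerivWithinAt)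
    (by simp [hn]) (fun s hs => by
      have hs' : s ∈ Set.Icc (0 : ℝ) 1 := ⟨hs.1, hs.2.le⟩
      refine (hle s hs').trans ?_
      rw [← mul_add]
      refine mul_le_mul_of_nonneg_left ?_ hK.le
      calc ‖h s‖ = ‖(h s - n s) + n s‖ := by rw [sub_add_cancel]
        _ ≤ ‖h s - n s‖ + ‖n s‖ := norm_add_le _ _
        _ ≤ _ := by gcongr; exact hnle s hs') 1 ⟨zero_le_one, le_rfl⟩
  rw [gronwallBound_of_K_ne_0 hK.ne', sub_zero] at key
  simp only [mul_one] at key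
  rw [mul_div_cancel_left₀ _ hK.ne'] at key
  calc ‖h 1‖ = ‖(h 1 - n 1) + n 1‖ := by rw [sub_add_cancel]
    _ ≤ ‖h 1 - n 1‖ + ‖n 1‖ := norm_add_le _ _
    _ ≤ (‖h 0‖ * Real.exp K + η * (Real.exp K - 1)) + η :=
      add_le_add key (hnle 1 ⟨zero_le_one, le_rfl⟩)
    _ = _ := by ring

/-- The part of the coefficient `T` which contains the potential. -/
def laxN (lam : ℂ) (q q' : Matrix (Fin 2) (Fin 2) ℂ) : Matrix BlockIdx BlockIdx ℂ :=
  (2 * lam) • laxU q + Complex.I • (laxSigma * (laxU q' - laxU q * laxU q))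

theorem continuous_laxN (lam : ℂ) : Continuous fun p : Matrix (Fin 2) (Fin 2) ℂ ×
    Matrix (Fin 2) (Fin 2) ℂ => laxN lam p.1 p.2 := by
  have h := continuous_laxU (continuous_fst (X := Matrix (Fin 2) (Fin 2) ℂ)
    (Y := Matrix (Fin 2) (Fin 2) ℂ))
  have h' := continuous_laxU (continuous_snd (X := Matrix (Fin 2) (Fin 2) ℂ)
    (Y := Matrix (Fin 2) (Fin 2) ℂ))
  exact (h.fun_const_smul _).add
    ((continuous_const.matrix_mul (h'.sub (h.matrix_mul h))).fun_const_smul _)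

theorem laxN_zero (lam : ℂ) : laxN lam 0 0 = 0 := by simp [laxN, laxU]

theorem exists_norm_laxN_le (lam : ℂ) (C : ℝ) : ∃ n0, ∀ q q' : Matrix (Fin 2) (Fin 2) ℂ,
    (∀ i j, ‖q i j‖ ≤ C) → (∀ i j, ‖q' i j‖ ≤ C) → ‖laxN lam q q'‖ ≤ n0 := by
  have hS : IsCompact (Set.pi Set.univ fun _ : Fin 2 => Set.pi Set.univ fun _ : Fin 2 =>
      Metric.closedBall (0 : ℂ) C) :=
    isCompact_univ_pi fun _ => isCompact_univ_pi fun _ => isCompact_closedBall _ _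
  obtain ⟨n0, hn0⟩ := (hS.prod hS).exists_bound_of_continuousOn (continuous_laxN lam).continuousOn
  refine ⟨n0, fun q q' hq hq' => hn0 (q, q') ⟨?_, ?_⟩⟩
  · exact fun i _ j _ => by simpa using hq i j
  · exact fun i _ j _ => by simpa using hq' i j

variable {Q : ℝ → ℝ → Matrix (Fin 2) (Fin 2) ℂ} {ε : ℝ} {E : Matrix BlockIdx (Fin 2) ℂ} {lam : ℂ}

/-- The coefficients of the `t`-part for solutions multiplied with `exp (i ε θ)`. -/
def dressedCoeffT (Q : ℝ → ℝ → Matrix (Fin 2) (Fin 2) ℂ) (ε x t : ℝ) (lam : ℂ) :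
    Matrix BlockIdx BlockIdx ℂ :=
  (2 * Complex.I * lam ^ 2) • ((ε : ℂ) • (1 : Matrix BlockIdx BlockIdx ℂ) - laxSigma)
    + laxN lam (Q x t) (matDx Q x t)

theorem hasDerivAt_dressed_t {x : ℝ} {w : ℝ → BlockIdx → ℂ}
    (hw : ∀ t i, HasDerivAt (fun s => w s i) ((laxT Q x t lam *ᵥ w t) i) t) (t : ℝ) :
    HasDerivAt (fun s : ℝ => Complex.exp (Complex.I * ε * gpTheta x s lam) • w s)
      (dressedCoeffT Q ε x t lam *ᵥ (Complex.exp (Complex.I * ε * gpTheta x t lam) • w t)) t := by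
  refine hasDerivAt_pi.2 fun i => ?_
  have hθ : HasDerivAt (fun s : ℝ => Complex.I * ε * gpTheta x s lam)
      (Complex.I * ε * (2 * lam ^ 2)) t := by
    have h1 : HasDerivAt (fun s : ℝ => (s : ℂ)) 1 t := Complex.ofRealCLM.hasDerivAt
    simpa [gpTheta] using
      ((h1.const_mul (2 * lam ^ 2)).const_add (lam * x)).const_mul (Complex.I * ε)
  refine (hθ.cexp.mul (hw t i)).congr_deriv ?_
  simp only [dressedCoeffT, laxT, laxN, mulVec_smul, add_mulVec, smul_mulVec, sub_mulVec,
    one_mulVec, Pi.smul_apply, Pi.add_apply, Pi.sub_apply, smul_eq_mul]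
  ring

/-- The coefficient was fixed by the behaviour at t = 0. For other t the dressed t-equation is used:
its constant part annihilates the column e of E, so the deviation from e has only the source built
from Q and Q_x, which disappears as x → ±∞. -/
theorem tendsto_exp_smul_laxFlow_mul (hQ : IsDecayingGPSolution Q) (hE : IsNormalization ε E)
    {l : Filter ℝ} [l.IsCountablyGenerated] (hl : l ≤ Filter.cocompact ℝ)
    (hlε : Filter.Tendsto (fun x => ε * x) l Filter.atBot) (hlam : 0 ≤ lam.im) (t : ℝ)
    (j : Fin 2) :
    Filter.Tendsto (fun x => (Complex.exp (Complex.I * ε * gpTheta x t lam) •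
      fun i => (laxFlow Q x t lam * jostCoeff Q ε E lam) i j : BlockIdx → ℂ)) l
      (𝓝 fun i => E i j) := by
  have hεε : ∀ x : ℝ, ε * (ε * x) = x := fun x => by
    rcases hE.sign with rfl | rfl <;> simp
  set e : BlockIdx → ℂ := fun i => E i j with he
  set c := jostCoeff Q ε E lam with hc
  set g : ℝ → ℝ → BlockIdx → ℂ := fun x s => Complex.exp (Complex.I * ε * gpTheta x s lam) •
      fun i => (laxFlow Q x s lam * c) i j with hg
  have hg0 : Filter.Tendsto (fun x => g x 0) l (𝓝 e) := by
    refine ((tendsto_dressedFlow hQ hE hlam j).comp hlε).congr fun x => ?_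
    simp only [Function.comp, dressedFlow_eq, hεε]
    rfl
  obtain ⟨C, hC⟩ := hQ.locally_bounded |t|
  obtain ⟨n0, hn0⟩ := exists_norm_laxN_le lam C
  have hst : ∀ s ∈ Set.Icc (0 : ℝ) 1, |s * t| ≤ |t| := fun s hs => by
    rw [abs_mul, abs_of_nonneg hs.1]
    exact mul_le_of_le_one_left (abs_nonneg _) hs.2
  have hN : ∀ x, ∀ s ∈ Set.Icc (0 : ℝ) 1, ‖laxN lam (Q x (s * t)) (matDx Q x (s * t))‖ ≤ n0 :=
    fun x s hs => hn0 _ _ (fun i j => (hC x _ i j (hst s hs)).1)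
      (fun i j => (hC x _ i j (hst s hs)).2)
  have hNc : Continuous fun p : ℝ × ℝ => laxN lam (Q p.1 p.2) (matDx Q p.1 p.2) :=
    (continuous_laxN lam).comp (hQ.continuous_Q.prodMk hQ.continuous_dx)
  set b : ℝ → ℝ → BlockIdx → ℂ :=
    fun x s => t • (laxN lam (Q x (s * t)) (matDx Q x (s * t)) *ᵥ e) with hb
  have hbc : ∀ x, Continuous (b x) := fun x =>
    ((hNc.comp (by fun_prop : Continuous fun s : ℝ => (x, s * t))).matrix_mulVec
      continuous_const).fun_const_smul t
  set m0 := ‖(2 * Complex.I * lam ^ 2) •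
    ((ε : ℂ) • (1 : Matrix BlockIdx BlockIdx ℂ) - laxSigma)‖ with hm0
  -- The summand 1 keeps `K` positive also for t = 0.
  set K := |t| * (m0 + |n0|) + 1 with hK
  have hK0 : 0 < K := by positivity
  have hest : ∀ x, ‖g x t - e‖ ≤
      (‖g x 0 - e‖ + ∫ s in (0 : ℝ)..1, ‖b x s‖) * Real.exp K := by
    intro x
    have hgd := hasDerivAt_dressed_t (Q := Q) (ε := ε) (x := x) (lam := lam)
      (w := fun s i => (laxFlow Q x s lam * c) i j)
      (fun s i => hasDerivAt_laxFlow_mul_t hQ x s lam c i j)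
    -- The time s t with s in [0, 1] treats both signs of t at once.
    have hhd : ∀ s : ℝ, HasDerivAt (fun s : ℝ => g x (s * t) - e)
        (t • (dressedCoeffT Q ε x (s * t) lam *ᵥ g x (s * t))) s := fun s => by
      have h1 : HasDerivAt (fun s : ℝ => s * t) t s := by
        simpa using (hasDerivAt_id s).mul_const t
      exact ((hgd (s * t)).scomp s h1).sub_const e
    have h := norm_le_mul_exp_of_source hK0 hhd (hbc x) (fun s hs => ?_)
    · simpa using h
    · have hMe : dressedCoeffT Q ε x (s * t) lam *ᵥ e
          = laxN lam (Q x (s * t)) (matDx Q x (s * t)) *ᵥ e := by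
        rw [dressedCoeffT, add_mulVec, smul_mulVec, sub_mulVec, smul_mulVec, one_mulVec,
          hE.sigma j, sub_self, smul_zero, zero_add]
      rw [hb]
      simp only
      rw [← hMe, ← smul_sub, ← mulVec_sub, norm_smul, Real.norm_eq_abs]
      have h1 : ‖dressedCoeffT Q ε x (s * t) lam‖ ≤ m0 + |n0| :=
        (norm_add_le _ _).trans (add_le_add le_rfl ((hN x s hs).trans (le_abs_self _)))
      calc |t| * ‖dressedCoeffT Q ε x (s * t) lam *ᵥ (g x (s * t) - e)‖
          ≤ |t| * ((m0 + |n0|) * ‖g x (s * t) - e‖) :=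
            mul_le_mul_of_nonneg_left ((linfty_opNorm_mulVec _ _).trans
              (mul_le_mul_of_nonneg_right h1 (norm_nonneg _))) (abs_nonneg _)
        _ ≤ K * ‖g x (s * t) - e‖ := by
            rw [← mul_assoc]
            exact mul_le_mul_of_nonneg_right (by simp [hK]) (norm_nonneg _)
  -- Dominated convergence: Q and Q_x decay at each fixed time and are bounded on the time strip up
  -- to |t|.
  have hint : Filter.Tendsto (fun x => ∫ s in (0 : ℝ)..1, ‖b x s‖) l (𝓝 0) := by
    have h := intervalIntegral.tendsto_integral_filter_of_dominated_convergence
      (l := l) (F := fun x s => ‖b x s‖) (f := fun _ => (0 : ℝ)) (a := 0) (b := 1)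
      (μ := MeasureTheory.volume) (fun _ => |t| * (|n0| * ‖e‖))
      (Filter.Eventually.of_forall fun x => (hbc x).norm.aestronglyMeasurable)
      (Filter.Eventually.of_forall fun x => Filter.Eventually.of_forall fun s hs => ?_)
      intervalIntegrable_const
      (Filter.Eventually.of_forall fun s _ => ?_)
    · simpa using h
    · rw [Set.uIoc_of_le zero_le_one] at hs
      rw [norm_norm, hb]
      simp only
      rw [norm_smul, Real.norm_eq_abs]
      refine mul_le_mul_of_nonneg_left ((linfty_opNorm_mulVec _ _).trans
        (mul_le_mul_of_nonneg_right ?_ (norm_nonneg _))) (abs_nonneg _)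
      exact (hN x s ⟨hs.1.le, hs.2⟩).trans (le_abs_self _)
    · have h1 : Filter.Tendsto (fun x => laxN lam (Q x (s * t)) (matDx Q x (s * t))) l (𝓝 0) := by
        have h2 := ((continuous_laxN lam).tendsto (0, 0)).comp
          ((((hQ.decay (s * t)).prodMk_nhds (hQ.decay_dx (s * t)))).mono_left hl)
        simpa only [laxN_zero, Function.comp_def] using h2
      have h3 : Continuous fun A : Matrix BlockIdx BlockIdx ℂ => ‖t • (A *ᵥ e)‖ :=
        ((continuous_id.matrix_mulVec continuous_const).fun_const_smul t).norm
      have h4 := (h3.tendsto 0).comp h1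
      simpa [hb, Function.comp_def] using h4
  refine tendsto_iff_norm_sub_tendsto_zero.2 (squeeze_zero (fun _ => norm_nonneg _) hest ?_)
  have := ((tendsto_iff_norm_sub_tendsto_zero.1 hg0).add hint).mul_const (Real.exp K)
  simpa using this

theorem isJostBlock_laxFlow_mul (hQ : IsDecayingGPSolution Q) (hE : IsNormalization ε E)
    {l : Filter ℝ} [l.IsCountablyGenerated] (hl : l ≤ Filter.cocompact ℝ)
    (hlε : Filter.Tendsto (fun x => ε * x) l Filter.atBot) (hlam : 0 ≤ lam.im) :
    IsJostBlock Q l ε E lam fun x t => laxFlow Q x t lam * jostCoeff Q ε E lam where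
  x_part x t i j := hasDerivAt_laxFlow_mul_x hQ x t lam _ i j
  t_part x t i j := hasDerivAt_laxFlow_mul_t hQ x t lam _ i j
  normalization t := tendsto_pi_nhds.2 fun i => tendsto_pi_nhds.2 fun j =>
    tendsto_pi_nhds.1 (tendsto_exp_smul_laxFlow_mul hQ hE hl hlε hlam t j) i

/-- The norm of a dressed difference is nonincreasing in y and tends to 0 as y → -∞, so it is 0. -/
theorem IsJostBlock.unique (hε : ε = 1 ∨ ε = -1) {l : Filter ℝ}
    (hlε : Filter.Tendsto (fun y => ε * y) Filter.atBot l) (hlam : 0 ≤ lam.im)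
    {ψ φ : ℝ → ℝ → Matrix BlockIdx (Fin 2) ℂ}
    (hψ : IsJostBlock Q l ε E lam ψ) (hφ : IsJostBlock Q l ε E lam φ) : ψ = φ := by
  have hεε : ∀ x : ℝ, ε * (ε * x) = x := fun x => by
    rcases hε with rfl | rfl <;> simp
  funext x t
  ext i j
  have hw : ∀ x i, HasDerivAt (fun y => ψ y t i j - φ y t i j)
      ((laxX Q x t lam *ᵥ fun i => ψ x t i j - φ x t i j) i) x := fun x i => by
    refine ((hψ.x_part x t i j).sub (hφ.x_part x t i j)).congr_deriv ?_
    simp only [mul_apply, mulVec, dotProduct, mul_sub, Finset.sum_sub_distrib]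
  set v := dressed ε t lam fun x i => ψ x t i j - φ x t i j with hv
  have hanti : Antitone fun y => euclNorm (v y) := euclNorm_dressed_antitone hε hlam hw
  have hlim : Filter.Tendsto (fun y => euclNorm (v y)) Filter.atBot (𝓝 0) := by
    have h0 : Filter.Tendsto v Filter.atBot (𝓝 0) := by
      refine tendsto_pi_nhds.2 fun i => ?_
      have h1 := ((tendsto_pi_nhds.1 (tendsto_pi_nhds.1 (hψ.normalization t) i) j).sub
        (tendsto_pi_nhds.1 (tendsto_pi_nhds.1 (hφ.normalization t) i) j)).comp hlε
      rw [sub_self] at h1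
      refine h1.congr fun y => ?_
      simp [hv, dressed, mul_sub]
    have := (continuous_euclNorm.tendsto 0).comp h0
    rwa [euclNorm_zero] at this
  have hle : euclNorm (v (ε * x)) ≤ 0 :=
    ge_of_tendsto hlim ((Filter.eventually_le_atBot (ε * x)).mono fun y hy => hanti hy)
  have h2 : v (ε * x) i = 0 := by
    have := (norm_le_euclNorm (v (ε * x)) i).trans hle
    simpa using this
  simp only [hv, dressed, Pi.smul_apply, smul_eq_mul, hεε, mul_eq_zero, Complex.exp_ne_zero,
    false_or] at h2
  exact sub_eq_zero.1 h2

theorem isNormalization_left : IsNormalization 1 (fromRows 1 0) where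
  sign := Or.inl rfl
  sigma j := by
    ext i
    rcases i with i | i <;> simp [laxSigma, mulVec, dotProduct, one_apply]
  le_one i j := by
    rcases i with i | i
    · by_cases h : i = j <;> simp [h]
    · simp

theorem isNormalization_right : IsNormalization (-1) (fromRows 0 1) where
  sign := Or.inr rfl
  sigma j := by
    ext i
    rcases i with i | i <;> simp [laxSigma, mulVec, dotProduct, one_apply, Matrix.neg_apply, neg_ite]
  le_one i j := by
    rcases i with i | i
    · simp
    · by_cases h : i = j <;> simp [h]

/-- The value of `ψ_{-L}` at the origin. -/
def coeffMinusL (Q : ℝ → ℝ → Matrix (Fin 2) (Fin 2) ℂ) (lam : ℂ) : Matrix BlockIdx (Fin 2) ℂ :=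
  jostCoeff Q 1 (fromRows 1 0) lam

/-- The value of `ψ_{+R}` at the origin. -/
def coeffPlusR (Q : ℝ → ℝ → Matrix (Fin 2) (Fin 2) ℂ) (lam : ℂ) : Matrix BlockIdx (Fin 2) ℂ :=
  jostCoeff Q (-1) (fromRows 0 1) lam

theorem isJostBlock_minusL (hQ : IsDecayingGPSolution Q) (hlam : 0 ≤ lam.im) :
    IsJostBlock Q Filter.atBot 1 (fromRows 1 0) lam
      fun x t => laxFlow Q x t lam * coeffMinusL Q lam := by
  have h := isJostBlock_laxFlow_mul hQ isNormalization_left atBot_le_cocompact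
    (by simp only [one_mul]; exact Filter.tendsto_id) hlam
  simpa [coeffMinusL] using h

theorem isJostBlock_plusR (hQ : IsDecayingGPSolution Q) (hlam : 0 ≤ lam.im) :
    IsJostBlock Q Filter.atTop (-1) (fromRows 0 1) lam
      fun x t => laxFlow Q x t lam * coeffPlusR Q lam := by
  have h := isJostBlock_laxFlow_mul hQ isNormalization_right atTop_le_cocompact
    (by simpa using Filter.tendsto_neg_atTop_atBot) hlam
  simpa [coeffPlusR] using h

theorem IsJostBlock.eq_minusL (hQ : IsDecayingGPSolution Q) (hlam : 0 ≤ lam.im)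
    {ψ : ℝ → ℝ → Matrix BlockIdx (Fin 2) ℂ}
    (hψ : IsJostBlock Q Filter.atBot 1 (fromRows 1 0) lam ψ) (x t : ℝ) :
    ψ x t = laxFlow Q x t lam * coeffMinusL Q lam := by
  have h := IsJostBlock.unique (ε := 1) (Or.inl rfl) (by simp only [one_mul]; exact Filter.tendsto_id) hlam
    (by simpa using hψ) (by simpa using isJostBlock_minusL hQ hlam)
  exact congrFun (congrFun h x) t

theorem IsJostBlock.eq_plusR (hQ : IsDecayingGPSolution Q) (hlam : 0 ≤ lam.im)
    {ψ : ℝ → ℝ → Matrix BlockIdx (Fin 2) ℂ}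
    (hψ : IsJostBlock Q Filter.atTop (-1) (fromRows 0 1) lam ψ) (x t : ℝ) :
    ψ x t = laxFlow Q x t lam * coeffPlusR Q lam := by
  have h := IsJostBlock.unique (ε := -1) (Or.inr rfl)
    (by simpa using Filter.tendsto_neg_atBot_atTop) hlam
    (by simpa using hψ) (by simpa using isJostBlock_plusR hQ hlam)
  exact congrFun (congrFun h x) t

/-- Existence makes the choice by `Classical.epsilon` a genuine Jost solution, and uniqueness
identifies it. -/
theorem psiMinusL_eq (hQ : IsDecayingGPSolution Q) (hlam : 0 ≤ lam.im) (x t : ℝ) :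
    psiMinusL Q x t lam = laxFlow Q x t lam * coeffMinusL Q lam :=
  (Classical.epsilon_spec ⟨_, isJostBlock_minusL hQ hlam⟩ :
    IsJostBlock Q Filter.atBot 1 (fromRows 1 0) lam _).eq_minusL hQ hlam x t

theorem psiPlusR_eq (hQ : IsDecayingGPSolution Q) (hlam : 0 ≤ lam.im) (x t : ℝ) :
    psiPlusR Q x t lam = laxFlow Q x t lam * coeffPlusR Q lam :=
  (Classical.epsilon_spec ⟨_, isJostBlock_plusR hQ hlam⟩ :
    IsJostBlock Q Filter.atTop (-1) (fromRows 0 1) lam _).eq_plusR hQ hlam x t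

end JostSolutions

/-! ### Reflection λ ↦ λ̄, isotropy and full rank. -/

noncomputable section Symmetry

open Matrix

/-- Entrywise complex conjugation. -/
abbrev mconj {m n : Type*} (M : Matrix m n ℂ) : Matrix m n ℂ := M.map (starRingEnd ℂ)

theorem mconj_mul {l m n : Type*} [Fintype m] (M : Matrix l m ℂ) (N : Matrix m n ℂ) :
    mconj (M * N) = mconj M * mconj N := Matrix.map_mul

theorem mconj_mconj {m n : Type*} (M : Matrix m n ℂ) : mconj (mconj M) = M := by
  ext i j
  simp

theorem mconj_smul {m n : Type*} (z : ℂ) (M : Matrix m n ℂ) :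
    mconj (z • M) = starRingEnd ℂ z • mconj M := by
  ext i j
  simp

theorem mconj_add {m n : Type*} (M N : Matrix m n ℂ) : mconj (M + N) = mconj M + mconj N := by
  ext i j
  simp

theorem mconj_sub {m n : Type*} (M N : Matrix m n ℂ) : mconj (M - N) = mconj M - mconj N := by
  ext i j
  simp

theorem mconj_neg {m n : Type*} (M : Matrix m n ℂ) : mconj (-M) = -mconj M := by
  ext i j
  simp

theorem mconj_J : mconj (J (Fin 2) ℂ) = J (Fin 2) ℂ := by
  ext i j
  rcases i with i | i <;> rcases j with j | j <;> simp [J, one_apply, apply_ite]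

theorem J_mul_mconj_laxSigma : J (Fin 2) ℂ * mconj laxSigma = -(laxSigma * J (Fin 2) ℂ) := by
  have : mconj laxSigma = laxSigma := by
    ext i j
    rcases i with i | i <;> rcases j with j | j <;> simp [laxSigma, one_apply, apply_ite]
  rw [this]
  simp [laxSigma, J, fromBlocks_multiply, fromBlocks_neg]

theorem J_mul_mconj_laxU {q : Matrix (Fin 2) (Fin 2) ℂ} (hq : q.IsSymm) :
    J (Fin 2) ℂ * mconj (laxU q) = laxU q * J (Fin 2) ℂ := by
  have h : mconj q = qᴴ := by
    ext i j
    simp [← hq.apply i j]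
  have h' : mconj (-qᴴ) = -q := by
    rw [← h]
    ext i j
    simp
  have h0 : mconj (0 : Matrix (Fin 2) (Fin 2) ℂ) = 0 := by ext i j; simp
  rw [laxU, mconj, fromBlocks_map]
  change J (Fin 2) ℂ * fromBlocks (mconj 0) (mconj q) (mconj (-qᴴ)) (mconj 0) = _
  rw [h, h', h0]
  simp [J, fromBlocks_multiply]

variable {Q : ℝ → ℝ → Matrix (Fin 2) (Fin 2) ℂ}

theorem J_mul_mconj_laxX (hQ : IsDecayingGPSolution Q) (x t : ℝ) (lam : ℂ) :
    J (Fin 2) ℂ * mconj (laxX Q x t lam)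
      = laxX Q x t (starRingEnd ℂ lam) * J (Fin 2) ℂ := by
  simp only [laxX, mconj_add, mconj_smul, mul_add, add_mul, mul_smul_comm, smul_mul_assoc,
    J_mul_mconj_laxSigma, J_mul_mconj_laxU (hQ.symm x t), map_mul, map_neg, Complex.conj_I]
  module

theorem J_mul_mconj_laxT (hQ : IsDecayingGPSolution Q) (x t : ℝ) (lam : ℂ) :
    J (Fin 2) ℂ * mconj (laxT Q x t lam)
      = laxT Q x t (starRingEnd ℂ lam) * J (Fin 2) ℂ := by
  have hs := J_mul_mconj_laxSigma
  have hu := J_mul_mconj_laxU (hQ.symm x t)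
  have hv := J_mul_mconj_laxU (matDx_isSymm hQ x t)
  simp only [laxT]
  generalize laxU (Q x t) = u at *
  generalize laxU (matDx Q x t) = v at *
  generalize laxSigma = s at *
  have h1 : J (Fin 2) ℂ * mconj (s * (v - u * u)) = -(s * (v - u * u) * J (Fin 2) ℂ) := by
    rw [mconj_mul, mconj_sub, mconj_mul, ← mul_assoc, hs, neg_mul, mul_assoc, mul_sub, hv,
      ← mul_assoc (J (Fin 2) ℂ), hu, mul_assoc u, hu, mul_assoc, sub_mul, mul_assoc]
  simp only [mconj_add, mconj_smul, mul_add, add_mul, mul_smul_comm, smul_mul_assoc, hs, hu, h1,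
    map_mul, map_neg, map_pow, Complex.conj_I, map_ofNat]
  module

/-- The symmetry `ψ ↦ s J ψ̄` between the Jost solutions at `λ` and at `λ̄`. -/
theorem IsJostBlock.conj (hQ : IsDecayingGPSolution Q) {l : Filter ℝ} {ε : ℝ}
    {E : Matrix BlockIdx (Fin 2) ℂ} {lam : ℂ} {ψ : ℝ → ℝ → Matrix BlockIdx (Fin 2) ℂ}
    (h : IsJostBlock Q l ε E lam ψ) (s : ℂ) :
    IsJostBlock Q l (-ε : ℝ) (s • (J (Fin 2) ℂ * mconj E)) (starRingEnd ℂ lam)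
      fun x t => s • (J (Fin 2) ℂ * mconj (ψ x t)) where
  x_part x t i j := by
    have hd : HasDerivAt (fun y => (s • (J (Fin 2) ℂ * mconj (ψ y t))) i j)
        ((s • (J (Fin 2) ℂ * mconj (laxX Q x t lam * ψ x t))) i j) x := by
      simp only [Matrix.smul_apply, Matrix.mul_apply (M := J (Fin 2) ℂ), Matrix.map_apply]
      exact (HasDerivAt.fun_sum fun k _ => ((h.x_part x t k j).star).const_mul _).const_mul s
    rw [mconj_mul, ← Matrix.mul_assoc, J_mul_mconj_laxX hQ, Matrix.mul_assoc,
      ← Matrix.mul_smul] at hd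
    exact hd
  t_part x t i j := by
    have hd : HasDerivAt (fun y => (s • (J (Fin 2) ℂ * mconj (ψ x y))) i j)
        ((s • (J (Fin 2) ℂ * mconj (laxT Q x t lam * ψ x t))) i j) t := by
      simp only [Matrix.smul_apply, Matrix.mul_apply (M := J (Fin 2) ℂ), Matrix.map_apply]
      exact (HasDerivAt.fun_sum fun k _ => ((h.t_part x t k j).star).const_mul _).const_mul s
    rw [mconj_mul, ← Matrix.mul_assoc, J_mul_mconj_laxT hQ, Matrix.mul_assoc,
      ← Matrix.mul_smul] at hd
    exact hd
  normalization t := by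
    have hc : Continuous fun M : Matrix BlockIdx (Fin 2) ℂ => s • (J (Fin 2) ℂ * mconj M) :=
      (continuous_const.matrix_mul (continuous_id.matrix_map Complex.continuous_conj)).fun_const_smul s
    refine ((hc.tendsto E).comp (h.normalization t)).congr fun x => ?_
    simp only [Function.comp, mconj_smul, Matrix.mul_smul, ← Complex.exp_conj, gpTheta, map_mul,
      map_add, map_pow, Complex.conj_I, Complex.conj_ofReal, map_ofNat, Complex.ofReal_neg]
    rw [smul_comm]
    congr 2
    ring

theorem J_mul_J_mul (M : Matrix BlockIdx (Fin 2) ℂ) :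
    J (Fin 2) ℂ * (J (Fin 2) ℂ * M) = -M := by
  rw [← Matrix.mul_assoc, J_squared, Matrix.neg_mul, Matrix.one_mul]

theorem mconj_fromRows_left : mconj (fromRows (1 : Matrix (Fin 2) (Fin 2) ℂ)
    (0 : Matrix (Fin 2) (Fin 2) ℂ)) = fromRows 1 0 := by
  ext i j
  rcases i with i | i <;> simp [one_apply, apply_ite]

theorem mconj_fromRows_right : mconj (fromRows (0 : Matrix (Fin 2) (Fin 2) ℂ)
    (1 : Matrix (Fin 2) (Fin 2) ℂ)) = fromRows 0 1 := by
  ext i j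
  rcases i with i | i <;> simp [one_apply, apply_ite]

theorem J_mul_fromRows_left : J (Fin 2) ℂ * fromRows (1 : Matrix (Fin 2) (Fin 2) ℂ)
    (0 : Matrix (Fin 2) (Fin 2) ℂ) = fromRows 0 1 := by
  simp [J, fromBlocks_mul_fromRows]

theorem J_mul_fromRows_right : J (Fin 2) ℂ * fromRows (0 : Matrix (Fin 2) (Fin 2) ℂ)
    (1 : Matrix (Fin 2) (Fin 2) ℂ) = -fromRows 1 0 := by
  simp [J, fromBlocks_mul_fromRows, fromRows_neg]

variable {lam : ℂ}

/-- The reflection of ψ_{+R} shows existence at λ̄. Whatever solution is chosen there is reflected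
back to λ, where uniqueness is known; the lower half plane thus needs no estimates of its own. -/
theorem psiPlusL_conj (hQ : IsDecayingGPSolution Q) (hlam : 0 ≤ lam.im) (x t : ℝ) :
    psiPlusL Q x t (starRingEnd ℂ lam)
      = -(J (Fin 2) ℂ * mconj (laxFlow Q x t lam * coeffPlusR Q lam)) := by
  have hex : IsJostBlock Q Filter.atTop 1 (fromRows 1 0) (starRingEnd ℂ lam)
      fun x t => (-1 : ℂ) • (J (Fin 2) ℂ * mconj (laxFlow Q x t lam * coeffPlusR Q lam)) := by
    have h := IsJostBlock.conj (ε := -1) hQ (by simpa using isJostBlock_plusR hQ hlam) (-1)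
    rw [mconj_fromRows_right, J_mul_fromRows_right] at h
    simpa using h
  have hspec : IsJostBlock Q Filter.atTop 1 (fromRows 1 0) (starRingEnd ℂ lam)
      fun x t => psiPlusL Q x t (starRingEnd ℂ lam) :=
    Classical.epsilon_spec (p := IsJostBlock Q Filter.atTop 1 (fromRows 1 0) (starRingEnd ℂ lam))
      ⟨_, hex⟩
  have hback : IsJostBlock Q Filter.atTop (-1) (fromRows 0 1) lam
      fun x t => (1 : ℂ) • (J (Fin 2) ℂ * mconj (psiPlusL Q x t (starRingEnd ℂ lam))) := by
    have h := IsJostBlock.conj (ε := 1) hQ (by simpa using hspec) 1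
    rw [mconj_fromRows_left, J_mul_fromRows_left] at h
    simpa using h
  rw [← hback.eq_plusR hQ hlam x t, one_smul, mconj_mul, mconj_J, mconj_mconj, J_mul_J_mul,
    neg_neg]

theorem psiMinusR_conj (hQ : IsDecayingGPSolution Q) (hlam : 0 ≤ lam.im) (x t : ℝ) :
    psiMinusR Q x t (starRingEnd ℂ lam)
      = J (Fin 2) ℂ * mconj (laxFlow Q x t lam * coeffMinusL Q lam) := by
  have hex : IsJostBlock Q Filter.atBot (-1) (fromRows 0 1) (starRingEnd ℂ lam)
      fun x t => (1 : ℂ) • (J (Fin 2) ℂ * mconj (laxFlow Q x t lam * coeffMinusL Q lam)) := by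
    have h := IsJostBlock.conj (ε := 1) hQ (by simpa using isJostBlock_minusL hQ hlam) 1
    rw [mconj_fromRows_left, J_mul_fromRows_left] at h
    simpa using h
  have hspec : IsJostBlock Q Filter.atBot (-1) (fromRows 0 1) (starRingEnd ℂ lam)
      fun x t => psiMinusR Q x t (starRingEnd ℂ lam) :=
    Classical.epsilon_spec (p := IsJostBlock Q Filter.atBot (-1) (fromRows 0 1)
      (starRingEnd ℂ lam)) ⟨_, hex⟩
  have hback : IsJostBlock Q Filter.atBot 1 (fromRows 1 0) lam
      fun x t => (-1 : ℂ) • (J (Fin 2) ℂ * mconj (psiMinusR Q x t (starRingEnd ℂ lam))) := by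
    have h := IsJostBlock.conj (ε := -1) hQ (by simpa using hspec) (-1)
    rw [mconj_fromRows_right, J_mul_fromRows_right] at h
    simpa using h
  rw [← hback.eq_minusL hQ hlam x t, neg_one_smul, mconj_neg, mconj_mul, mconj_J, mconj_mconj,
    Matrix.mul_neg, J_mul_J_mul, neg_neg]

/-- The conjugate transpose at λ̄ becomes a plain transpose at λ, so a is bilinear in analytic
functions of λ and therefore analytic. -/
theorem scatA_eq (hQ : IsDecayingGPSolution Q) (hlam : 0 ≤ lam.im) :
    scatA Q lam = (coeffPlusR Q lam)ᵀ * J (Fin 2) ℂ * coeffMinusL Q lam := by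
  rw [scatA, psiPlusL_conj hQ hlam, psiMinusL_eq hQ hlam, laxFlow_zero, Matrix.one_mul,
    Matrix.one_mul, conjTranspose_neg, conjTranspose_mul]
  congr 1
  have h1 : (mconj (coeffPlusR Q lam))ᴴ = (coeffPlusR Q lam)ᵀ := by
    ext i j
    simp
  have h2 : (J (Fin 2) ℂ)ᴴ = -J (Fin 2) ℂ := by
    rw [conjTranspose, J_transpose]
    exact (mconj_neg _).trans (congrArg _ mconj_J)
  rw [h1, h2, Matrix.mul_neg, neg_neg]

/-- A Jost block is isotropic for the symplectic form. -/
theorem IsJostBlock.transpose_mul_J_mul_eq_zero (hQ : IsDecayingGPSolution Q) {l : Filter ℝ}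
    [l.NeBot] {ε : ℝ} {E C : Matrix BlockIdx (Fin 2) ℂ}
    (h : IsJostBlock Q l ε E lam fun x t => laxFlow Q x t lam * C)
    (hlε : Filter.Tendsto (fun x => ε * x) l Filter.atBot) (hlam : 0 ≤ lam.im)
    (hE : Eᵀ * J (Fin 2) ℂ * E = 0) : Cᵀ * J (Fin 2) ℂ * C = 0 := by
  have hc : Continuous fun M : Matrix BlockIdx (Fin 2) ℂ => Mᵀ * J (Fin 2) ℂ * M :=
    (continuous_id.matrix_transpose.matrix_mul continuous_const).matrix_mul continuous_id
  have hlim := (hc.tendsto E).comp (h.normalization 0)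
  rw [hE] at hlim
  ext i j
  have hij := (tendsto_pi_nhds.1 (tendsto_pi_nhds.1 hlim i) j).norm
  rw [Matrix.zero_apply, norm_zero] at hij
  -- The flow preserves the form, so the dressed solution carries it times exp(2iεθ), which has
  -- modulus at least 1 for εx ≤ 0. A constant is thus bounded by a quantity tending to 0.
  have hle : ‖(Cᵀ * J (Fin 2) ℂ * C) i j‖ ≤ 0 := by
    refine ge_of_tendsto hij ?_
    filter_upwards [hlε.eventually_le_atBot 0] with x hx
    have e : ((Complex.exp (Complex.I * ε * gpTheta x 0 lam) • (laxFlow Q x 0 lam * C))ᵀ *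
        J (Fin 2) ℂ * (Complex.exp (Complex.I * ε * gpTheta x 0 lam) • (laxFlow Q x 0 lam * C)))
        = (Complex.exp (Complex.I * ε * gpTheta x 0 lam)) ^ 2 • (Cᵀ * J (Fin 2) ℂ * C) := by
      rw [transpose_smul, transpose_mul, Matrix.smul_mul, Matrix.smul_mul, Matrix.mul_smul,
        smul_smul, ← sq]
      conv_rhs => rw [← laxFlow_symplectic hQ x 0 lam]
      simp only [Matrix.mul_assoc]
    simp only [Function.comp]
    rw [e, Matrix.smul_apply, norm_smul, norm_pow]
    refine le_mul_of_one_le_left (norm_nonneg _) (one_le_pow₀ ?_)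
    rw [Complex.norm_exp, Real.one_le_exp_iff]
    have : (Complex.I * ε * gpTheta x 0 lam).re = -(ε * x) * lam.im := by
      simp [gpTheta]
      ring
    rw [this]
    exact mul_nonneg (by linarith) hlam
  simpa using hle

/-- A Jost block has full rank. -/
theorem IsJostBlock.mulVec_injective {l : Filter ℝ}
    [l.NeBot] {ε : ℂ} {E C : Matrix BlockIdx (Fin 2) ℂ}
    (h : IsJostBlock Q l ε E lam fun x t => laxFlow Q x t lam * C)
    (hE : ∀ v, E *ᵥ v = 0 → v = 0) (v : Fin 2 → ℂ) (hv : C *ᵥ v = 0) : v = 0 := by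
  refine hE v ?_
  have hc : Continuous fun M : Matrix BlockIdx (Fin 2) ℂ => M *ᵥ v :=
    continuous_id.matrix_mulVec continuous_const
  have hlim := (hc.tendsto E).comp (h.normalization 0)
  refine tendsto_nhds_unique hlim (tendsto_const_nhds.congr fun x => ?_)
  simp only [Function.comp]
  rw [smul_mulVec, ← mulVec_mulVec, hv, mulVec_zero, smul_zero]

theorem coeffMinusL_isotropic (hQ : IsDecayingGPSolution Q) (hlam : 0 ≤ lam.im) :
    (coeffMinusL Q lam)ᵀ * J (Fin 2) ℂ * coeffMinusL Q lam = 0 := by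
  refine IsJostBlock.transpose_mul_J_mul_eq_zero (ε := 1) hQ
    (by simpa using isJostBlock_minusL hQ hlam) (by simp only [one_mul]; exact Filter.tendsto_id)
    hlam ?_
  rw [Matrix.mul_assoc, J_mul_fromRows_left, transpose_fromRows, fromCols_mul_fromRows]
  simp

theorem coeffPlusR_isotropic (hQ : IsDecayingGPSolution Q) (hlam : 0 ≤ lam.im) :
    (coeffPlusR Q lam)ᵀ * J (Fin 2) ℂ * coeffPlusR Q lam = 0 := by
  refine IsJostBlock.transpose_mul_J_mul_eq_zero (ε := -1) hQ
    (by simpa using isJostBlock_plusR hQ hlam) (by simpa using Filter.tendsto_neg_atTop_atBot)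
    hlam ?_
  rw [Matrix.mul_assoc, J_mul_fromRows_right, transpose_fromRows, Matrix.mul_neg,
    fromCols_mul_fromRows]
  simp

theorem coeffMinusL_injective (hQ : IsDecayingGPSolution Q) (hlam : 0 ≤ lam.im) (v : Fin 2 → ℂ)
    (hv : coeffMinusL Q lam *ᵥ v = 0) : v = 0 := by
  refine (isJostBlock_minusL hQ hlam).mulVec_injective (fun w hw => ?_) v hv
  rw [fromRows_mulVec, one_mulVec] at hw
  exact funext fun i => congrFun hw (Sum.inl i)

theorem coeffPlusR_injective (hQ : IsDecayingGPSolution Q) (hlam : 0 ≤ lam.im) (v : Fin 2 → ℂ)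
    (hv : coeffPlusR Q lam *ᵥ v = 0) : v = 0 := by
  refine (isJostBlock_plusR hQ hlam).mulVec_injective (fun w hw => ?_) v hv
  rw [fromRows_mulVec, one_mulVec] at hw
  exact funext fun i => congrFun hw (Sum.inr i)

end Symmetry

/-! ### Calculus of matrix functions of the spectral parameter. -/

noncomputable section SpectralParameter

open Matrix

/-- Entrywise analyticity. -/
def MatAnalyticAt {m k : Type*} (F : ℂ → Matrix m k ℂ) (z : ℂ) : Prop :=
  ∀ i j, AnalyticAt ℂ (fun w => F w i j) z

variable {l m k : Type*} {z : ℂ}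

theorem matAnalyticAt_const (M : Matrix m k ℂ) : MatAnalyticAt (fun _ => M) z :=
  fun _ _ => analyticAt_const

theorem MatAnalyticAt.mul [Fintype m] {F : ℂ → Matrix l m ℂ} {G : ℂ → Matrix m k ℂ}
    (hF : MatAnalyticAt F z) (hG : MatAnalyticAt G z) : MatAnalyticAt (fun w => F w * G w) z := by
  intro i j
  simp only [Matrix.mul_apply]
  exact Finset.analyticAt_fun_sum _ fun a _ => (hF i a).mul (hG a j)

theorem MatAnalyticAt.smul {f : ℂ → ℂ} {F : ℂ → Matrix m k ℂ}
    (hf : AnalyticAt ℂ f z) (hF : MatAnalyticAt F z) : MatAnalyticAt (fun w => f w • F w) z :=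
  fun i j => hf.mul (hF i j)

theorem MatAnalyticAt.neg {F : ℂ → Matrix m k ℂ}
    (hF : MatAnalyticAt F z) : MatAnalyticAt (fun w => -F w) z :=
  fun i j => (hF i j).neg

theorem MatAnalyticAt.transpose {F : ℂ → Matrix m k ℂ}
    (hF : MatAnalyticAt F z) : MatAnalyticAt (fun w => (F w)ᵀ) z :=
  fun i j => hF j i

theorem MatAnalyticAt.det {F : ℂ → Matrix (Fin 2) (Fin 2) ℂ}
    (hF : MatAnalyticAt F z) : AnalyticAt ℂ (fun w => (F w).det) z := by
  simp only [det_fin_two]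
  exact ((hF 0 0).mul (hF 1 1)).sub ((hF 0 1).mul (hF 1 0))

theorem MatAnalyticAt.adjugate {F : ℂ → Matrix (Fin 2) (Fin 2) ℂ}
    (hF : MatAnalyticAt F z) : MatAnalyticAt (fun w => (F w).adjugate) z := by
  simp only [adjugate_fin_two]
  intro i j
  fin_cases i <;> fin_cases j
  · exact hF 1 1
  · exact (hF 0 1).neg
  · exact (hF 1 0).neg
  · exact hF 0 0

theorem MatAnalyticAt.inv {F : ℂ → Matrix (Fin 2) (Fin 2) ℂ}
    (hF : MatAnalyticAt F z) (h0 : (F z).det ≠ 0) : MatAnalyticAt (fun w => (F w)⁻¹) z := by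
  simp only [inv_def, Ring.inverse_eq_inv']
  exact MatAnalyticAt.smul (hF.det.inv h0) hF.adjugate

theorem matIterDeriv_congr {F G : ℂ → Matrix m k ℂ} (h : F =ᶠ[𝓝 z] G) (n : ℕ) :
    matIterDeriv n F z = matIterDeriv n G z := by
  ext i j
  exact Filter.EventuallyEq.iteratedDeriv_eq n (h.mono fun w hw => congrFun (congrFun hw i) j)

theorem matIterDeriv_zero (F : ℂ → Matrix m k ℂ) : matIterDeriv 0 F z = F z := by
  ext i j
  simp [matIterDeriv]

theorem matIterDeriv_add {F G : ℂ → Matrix m k ℂ} (hF : MatAnalyticAt F z)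
    (hG : MatAnalyticAt G z) (n : ℕ) :
    matIterDeriv n (fun w => F w + G w) z = matIterDeriv n F z + matIterDeriv n G z := by
  ext i j
  exact iteratedDeriv_fun_add (hF i j).contDiffAt (hG i j).contDiffAt

/-- The Leibniz rule for products of matrix functions. -/
theorem matIterDeriv_mul [Fintype m] {F : ℂ → Matrix l m ℂ} {G : ℂ → Matrix m k ℂ}
    (hF : MatAnalyticAt F z) (hG : MatAnalyticAt G z) (n : ℕ) :
    ((n.factorial : ℂ))⁻¹ • matIterDeriv n (fun w => F w * G w) z
      = ∑ p ∈ Finset.HasAntidiagonal.antidiagonal n, ((p.1.factorial : ℂ) * (p.2.factorial : ℂ))⁻¹ •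
          (matIterDeriv p.2 F z * matIterDeriv p.1 G z) := by
  rw [← Finset.Nat.sum_antidiagonal_swap]
  simp only [Prod.fst_swap, Prod.snd_swap]
  rw [Finset.Nat.sum_antidiagonal_eq_sum_range_succ
    (fun a b => (((b.factorial : ℂ) * (a.factorial : ℂ))⁻¹ •
      (matIterDeriv a F z * matIterDeriv b G z)))]
  ext i j
  have h1 : matIterDeriv n (fun w => F w * G w) z i j
      = ∑ a, iteratedDeriv n (fun w => F w i a * G w a j) z := by
    simp only [matIterDeriv, of_apply, Matrix.mul_apply]
    exact iteratedDeriv_fun_sum fun a _ => ((hF i a).mul (hG a j)).contDiffAt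
  rw [Matrix.smul_apply, h1, Matrix.sum_apply]
  simp only [Matrix.smul_apply, Matrix.mul_apply, smul_eq_mul, Finset.mul_sum]
  rw [Finset.sum_comm]
  refine Finset.sum_congr rfl fun a _ => ?_
  have h2 := iteratedDeriv_fun_mul (n := n) (hF i a).contDiffAt (hG a j).contDiffAt
  rw [h2, Finset.mul_sum]
  refine Finset.sum_congr rfl fun b hb => ?_
  have hbn : b ≤ n := Nat.lt_succ_iff.1 (Finset.mem_range.1 hb)
  rw [Nat.cast_choose ℂ hbn]
  have h3 : (n.factorial : ℂ) ≠ 0 := by exact_mod_cast n.factorial_ne_zero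
  simp only [matIterDeriv, of_apply]
  field_simp

/-- Orders of vanishing add under multiplication, so every entry vanishes at least to the order of
f. -/
theorem matIterDeriv_smul_eq_zero {f : ℂ → ℂ} {F : ℂ → Matrix m k ℂ} (hf : AnalyticAt ℂ f z)
    (hF : MatAnalyticAt F z) {N n : ℕ} (hN : (N : ℕ∞) ≤ analyticOrderAt f z) (hn : n < N) :
    matIterDeriv n (fun w => f w • F w) z = 0 := by
  ext i j
  have h : AnalyticAt ℂ (fun w => f w * F w i j) z := hf.mul (hF i j)
  refine (natCast_le_analyticOrderAt_iff_iteratedDeriv_eq_zero h).1 ?_ n hn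
  refine hN.trans ?_
  have := analyticOrderAt_mul hf (hF i j)
  change analyticOrderAt (fun w => f w * F w i j) z = _ at this
  rw [this]
  exact le_self_add

theorem iteratedDeriv_conj_conj (n : ℕ) (f : ℂ → ℂ) (z : ℂ) :
    iteratedDeriv n (fun w => starRingEnd ℂ (f (starRingEnd ℂ w))) z
      = starRingEnd ℂ (iteratedDeriv n f (starRingEnd ℂ z)) := by
  induction n generalizing z with
  | zero => simp
  | succ n ih =>
    rw [iteratedDeriv_succ, iteratedDeriv_succ, funext ih]
    exact congrFun (deriv_conj_conj (f := iteratedDeriv n f)) z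

theorem MatAnalyticAt.conj_conj {F : ℂ → Matrix m k ℂ} (hF : MatAnalyticAt F z) :
    MatAnalyticAt (fun w => mconj (F (starRingEnd ℂ w))) (starRingEnd ℂ z) := by
  intro i j
  have h : ∀ᶠ w in 𝓝 (starRingEnd ℂ z), AnalyticAt ℂ (fun w => F w i j) (starRingEnd ℂ w) :=
    (Complex.continuous_conj.tendsto' _ z (by simp)).eventually (hF i j).eventually_analyticAt
  refine Complex.analyticAt_iff_eventually_differentiableAt.2 (h.mono fun w hw => ?_)
  have := hw.differentiableAt.conj_conj
  rw [starRingEnd_self_apply] at this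
  exact this

theorem matIterDeriv_mul_conj_conj [Fintype l] (M : Matrix m l ℂ) {F : ℂ → Matrix l k ℂ}
    (hF : MatAnalyticAt F z) (n : ℕ) :
    matIterDeriv n (fun w => M * mconj (F (starRingEnd ℂ w))) (starRingEnd ℂ z)
      = M * mconj (matIterDeriv n F z) := by
  ext i j
  simp only [matIterDeriv, of_apply, Matrix.mul_apply]
  have h : ∀ a ∈ Finset.univ, ContDiffAt ℂ n
      (fun w => M i a * mconj (F (starRingEnd ℂ w)) a j) (starRingEnd ℂ z) := fun a _ =>
    (analyticAt_const.mul (hF.conj_conj a j)).contDiffAt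
  rw [iteratedDeriv_fun_sum h]
  refine Finset.sum_congr rfl fun a _ => ?_
  simp only [Matrix.map_apply]
  rw [iteratedDeriv_const_mul_field, iteratedDeriv_conj_conj n fun w => F w a j,
    starRingEnd_self_apply]
  rfl

/-- Since n < N, the truncation of both indices below N loses no pair with sum n. -/
theorem sum_sum_ite_eq_sum_antidiagonal {M : Type*} [AddCommMonoid M] {N n : ℕ} (hn : n < N)
    (f : ℕ → ℕ → M) :
    (∑ j : Fin N, ∑ k : Fin N, if (j : ℕ) + (k : ℕ) = n then f j k else 0)
      = ∑ p ∈ Finset.HasAntidiagonal.antidiagonal n, f p.1 p.2 := by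
  rw [Fin.sum_univ_eq_sum_range (fun j => ∑ k : Fin N, if j + (k : ℕ) = n then f j k else 0)]
  simp only [fun j => Fin.sum_univ_eq_sum_range (fun k => if j + k = n then f j k else 0) N]
  rw [← Finset.sum_product', ← Finset.sum_filter (s := Finset.range N ×ˢ Finset.range N)
    (p := fun p : ℕ × ℕ => p.1 + p.2 = n) (f := fun p => f p.1 p.2)]
  refine Finset.sum_congr ?_ fun _ _ => rfl
  ext p
  simp only [Finset.mem_filter, Finset.mem_product, Finset.mem_range,
    Finset.HasAntidiagonal.mem_antidiagonal]
  omega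

end SpectralParameter

/-! ### Isotropic decomposition and the norming constants. -/

noncomputable section NormingConstants

open Matrix

/-- The decomposition of `ℂ⁴` along two transversal isotropic planes. -/
theorem isotropic_decomposition {c r : Matrix BlockIdx (Fin 2) ℂ} {H : Matrix (Fin 2) (Fin 2) ℂ}
    (hc : cᵀ * J (Fin 2) ℂ * c = 0) (hr : rᵀ * J (Fin 2) ℂ * r = 0)
    (hH : cᵀ * J (Fin 2) ℂ * r = -H) (hdet : H.det ≠ 0) :
    c * ((Hᵀ)⁻¹ * (rᵀ * J (Fin 2) ℂ)) - r * (H⁻¹ * (cᵀ * J (Fin 2) ℂ)) = 1 := by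
  have hG : rᵀ * J (Fin 2) ℂ * c = Hᵀ := by
    have := congrArg Matrix.transpose hH
    rw [transpose_mul, transpose_mul, J_transpose, transpose_transpose, Matrix.neg_mul,
      Matrix.mul_neg, ← Matrix.mul_assoc, transpose_neg] at this
    exact neg_injective this
  have hu : IsUnit H.det := isUnit_iff_ne_zero.2 hdet
  have hu' : IsUnit (Hᵀ).det := by rwa [det_transpose]
  have h1 : fromRows ((Hᵀ)⁻¹ * (rᵀ * J (Fin 2) ℂ)) (-(H⁻¹ * (cᵀ * J (Fin 2) ℂ))) * fromCols c r
      = 1 := by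
    rw [fromRows_mul_fromCols, Matrix.mul_assoc, hG, Matrix.mul_assoc, hr, Matrix.neg_mul,
      Matrix.mul_assoc, hc, Matrix.neg_mul, Matrix.mul_assoc, hH, nonsing_inv_mul _ hu',
      Matrix.mul_neg, nonsing_inv_mul _ hu, Matrix.mul_zero, Matrix.mul_zero, neg_zero, neg_neg,
      fromBlocks_one]
  -- Isotropy makes the pairing of the two frames block diagonal, giving a left inverse of [c r];
  -- for square matrices it is also a right inverse, which is the decomposition of the identity.
  have h2 := mul_eq_one_comm.1 h1
  rw [fromCols_mul_fromRows, Matrix.mul_neg, ← sub_eq_add_neg] at h2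
  exact h2

/-- For 2 × 2 matrices both symmetry conditions are the same scalar equation. No division by det a
occurs, so singular a is allowed. -/
theorem isSymm_mul_adjugate {s a : Matrix (Fin 2) (Fin 2) ℂ} (h : (sᵀ * a).IsSymm) :
    (s * a.adjugate).IsSymm := by
  have h01 := h.apply 0 1
  simp only [Matrix.mul_apply, transpose_apply, Fin.sum_univ_two] at h01
  ext i j
  rw [transpose_apply, adjugate_fin_two]
  fin_cases i <;> fin_cases j
  · rfl
  · simp [Matrix.mul_apply, Fin.sum_univ_two]
    linear_combination -h01
  · simp [Matrix.mul_apply, Fin.sum_univ_two]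
    linear_combination h01
  · rfl

/-- With `c` and `r` transversal isotropic planes as above, `p` isotropic and `a = rᵀ J p`, the
component of `p adj a` along `r` is symmetric. -/
theorem isSymm_component {c r p : Matrix BlockIdx (Fin 2) ℂ} {H : Matrix (Fin 2) (Fin 2) ℂ}
    (hc : cᵀ * J (Fin 2) ℂ * c = 0) (hr : rᵀ * J (Fin 2) ℂ * r = 0)
    (hH : cᵀ * J (Fin 2) ℂ * r = -H) (hdet : H.det ≠ 0) (hp : pᵀ * J (Fin 2) ℂ * p = 0) :
    (H⁻¹ * (cᵀ * J (Fin 2) ℂ * p) * (rᵀ * J (Fin 2) ℂ * p).adjugate).IsSymm := by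
  refine isSymm_mul_adjugate ?_
  set s := H⁻¹ * (cᵀ * J (Fin 2) ℂ * p) with hs
  set a := rᵀ * J (Fin 2) ℂ * p with ha
  have hdec := isotropic_decomposition hc hr hH hdet
  have h1 : pᵀ * J (Fin 2) ℂ * c = -(cᵀ * J (Fin 2) ℂ * p)ᵀ := by
    rw [transpose_mul, transpose_mul, J_transpose, transpose_transpose, Matrix.neg_mul,
      Matrix.mul_neg, neg_neg, Matrix.mul_assoc]
  have h2 : pᵀ * J (Fin 2) ℂ * r = -aᵀ := by
    rw [ha, transpose_mul, transpose_mul, J_transpose, transpose_transpose, Matrix.neg_mul,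
      Matrix.mul_neg, neg_neg, Matrix.mul_assoc]
  -- Insert the decomposition of the identity into pᵀJp = 0; the two resulting terms are sᵀa and its
  -- transpose.
  have h3 : pᵀ * J (Fin 2) ℂ * (c * ((Hᵀ)⁻¹ * (rᵀ * J (Fin 2) ℂ))
      - r * (H⁻¹ * (cᵀ * J (Fin 2) ℂ))) * p = 0 := by rw [hdec, Matrix.mul_one, hp]
  have h4 : pᵀ * J (Fin 2) ℂ * (c * ((Hᵀ)⁻¹ * (rᵀ * J (Fin 2) ℂ))
      - r * (H⁻¹ * (cᵀ * J (Fin 2) ℂ))) * p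
      = (pᵀ * J (Fin 2) ℂ * c) * (Hᵀ)⁻¹ * a - (pᵀ * J (Fin 2) ℂ * r) * s := by
    simp only [hs, ha, Matrix.mul_sub, Matrix.sub_mul, Matrix.mul_assoc]
  have h5 : sᵀ = (cᵀ * J (Fin 2) ℂ * p)ᵀ * (Hᵀ)⁻¹ := by
    rw [hs, transpose_mul, transpose_nonsing_inv]
  rw [h4, h1, h2, Matrix.neg_mul, ← h5, Matrix.neg_mul, Matrix.neg_mul] at h3
  have h6 : sᵀ * a = aᵀ * s := by
    rw [neg_sub_neg, sub_eq_zero] at h3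
    exact h3.symm
  rw [IsSymm, transpose_mul, transpose_transpose, h6]

variable {Q : ℝ → ℝ → Matrix (Fin 2) (Fin 2) ℂ} {lam lam0 : ℂ}

/-- An isotropic complement of the range of `ψ_{+R}(0,0;λ₀)`. -/
def isotropicComplement (Q : ℝ → ℝ → Matrix (Fin 2) (Fin 2) ℂ) (lam0 : ℂ) :
    Matrix BlockIdx (Fin 2) ℂ :=
  -(J (Fin 2) ℂ * mconj (coeffPlusR Q lam0))

/-- The Gram matrix which expresses the transversality of the isotropic complement. -/
def gramMatrix (Q : ℝ → ℝ → Matrix (Fin 2) (Fin 2) ℂ) (lam0 lam : ℂ) :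
    Matrix (Fin 2) (Fin 2) ℂ :=
  (mconj (coeffPlusR Q lam0))ᵀ * coeffPlusR Q lam

/-- The matrix function `β(λ)` whose derivatives at `λ₀` are the norming constants. -/
def normingFunction (Q : ℝ → ℝ → Matrix (Fin 2) (Fin 2) ℂ) (lam0 lam : ℂ) :
    Matrix (Fin 2) (Fin 2) ℂ :=
  -((gramMatrix Q lam0 lam)⁻¹ * ((isotropicComplement Q lam0)ᵀ * J (Fin 2) ℂ * coeffMinusL Q lam)
    * ((coeffPlusR Q lam)ᵀ * J (Fin 2) ℂ * coeffMinusL Q lam).adjugate)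

theorem isotropicComplement_transpose_mul_J :
    (isotropicComplement Q lam0)ᵀ * J (Fin 2) ℂ = -(mconj (coeffPlusR Q lam0))ᵀ := by
  rw [isotropicComplement, transpose_neg, transpose_mul, J_transpose, Matrix.mul_neg, neg_neg,
    Matrix.mul_assoc, J_squared, Matrix.mul_neg, Matrix.mul_one]

theorem isotropicComplement_isotropic (hQ : IsDecayingGPSolution Q) (h0 : 0 ≤ lam0.im) :
    (isotropicComplement Q lam0)ᵀ * J (Fin 2) ℂ * isotropicComplement Q lam0 = 0 := by
  rw [isotropicComplement_transpose_mul_J, isotropicComplement, Matrix.mul_neg, Matrix.neg_mul,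
    neg_neg, ← Matrix.mul_assoc]
  have h := congrArg mconj (coeffPlusR_isotropic hQ h0)
  rw [mconj_mul, mconj_mul, mconj_J] at h
  have hz : mconj (0 : Matrix (Fin 2) (Fin 2) ℂ) = 0 := by ext i j; simp
  rw [hz] at h
  exact h

theorem isotropicComplement_mul_coeffPlusR :
    (isotropicComplement Q lam0)ᵀ * J (Fin 2) ℂ * coeffPlusR Q lam = -gramMatrix Q lam0 lam := by
  rw [isotropicComplement_transpose_mul_J, Matrix.neg_mul, gramMatrix]

-- At λ = λ₀ the Gram matrix is r†r, invertible because r has full rank. Choosing the complement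
-- through the conjugate of r(λ₀) serves this purpose, and keeping it fixed preserves analyticity in
-- λ.
open scoped ComplexOrder in
theorem det_gramMatrix_ne_zero (hQ : IsDecayingGPSolution Q) (h0 : 0 ≤ lam0.im) :
    (gramMatrix Q lam0 lam0).det ≠ 0 := by
  intro h
  obtain ⟨v, hv0, hv⟩ := exists_mulVec_eq_zero_iff.2 h
  have h1 : ((coeffPlusR Q lam0)ᴴ * coeffPlusR Q lam0) *ᵥ v = 0 := hv
  rw [conjTranspose_mul_self_mulVec_eq_zero] at h1
  exact hv0 (coeffPlusR_injective hQ h0 v h1)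

theorem matAnalyticAt_coeffMinusL (hQ : IsDecayingGPSolution Q) (h : 0 < lam.im) :
    MatAnalyticAt (coeffMinusL Q) lam := fun i j =>
  (differentiableOn_jostCoeff hQ isNormalization_left i j).analyticAt
    ((isOpen_lt continuous_const Complex.continuous_im).mem_nhds h)

theorem matAnalyticAt_coeffPlusR (hQ : IsDecayingGPSolution Q) (h : 0 < lam.im) :
    MatAnalyticAt (coeffPlusR Q) lam := fun i j =>
  (differentiableOn_jostCoeff hQ isNormalization_right i j).analyticAt
    ((isOpen_lt continuous_const Complex.continuous_im).mem_nhds h)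

theorem matAnalyticAt_laxFlow (hQ : IsDecayingGPSolution Q) (x t : ℝ) :
    MatAnalyticAt (laxFlow Q x t) lam := fun i j =>
  (differentiable_laxFlow hQ x t i j).analyticAt lam

theorem matAnalyticAt_gramMatrix (hQ : IsDecayingGPSolution Q) (h : 0 < lam.im) :
    MatAnalyticAt (gramMatrix Q lam0) lam :=
  (matAnalyticAt_const _).mul (matAnalyticAt_coeffPlusR hQ h)

theorem matAnalyticAt_scatA_formula (hQ : IsDecayingGPSolution Q) (h : 0 < lam.im) :
    MatAnalyticAt (fun lam => (coeffPlusR Q lam)ᵀ * J (Fin 2) ℂ * coeffMinusL Q lam) lam :=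
  ((matAnalyticAt_coeffPlusR hQ h).transpose.mul (matAnalyticAt_const _)).mul
    (matAnalyticAt_coeffMinusL hQ h)

theorem matAnalyticAt_normingFunction (hQ : IsDecayingGPSolution Q) (h0 : 0 < lam0.im) :
    MatAnalyticAt (normingFunction Q lam0) lam0 :=
  ((((matAnalyticAt_gramMatrix hQ h0).inv (det_gramMatrix_ne_zero hQ h0.le)).mul
    ((matAnalyticAt_const _).mul (matAnalyticAt_coeffMinusL hQ h0))).mul
    (matAnalyticAt_scatA_formula hQ h0).adjugate).neg

theorem eventually_im_pos (h0 : 0 < lam0.im) : ∀ᶠ lam in 𝓝 lam0, 0 < lam.im :=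
  (isOpen_lt continuous_const Complex.continuous_im).mem_nhds h0

theorem eventually_det_gramMatrix_ne_zero (hQ : IsDecayingGPSolution Q) (h0 : 0 < lam0.im) :
    ∀ᶠ lam in 𝓝 lam0, (gramMatrix Q lam0 lam).det ≠ 0 :=
  (matAnalyticAt_gramMatrix hQ h0).det.continuousAt.eventually_ne
    (det_gramMatrix_ne_zero hQ h0.le)

theorem normingFunction_isSymm (hQ : IsDecayingGPSolution Q) (h0 : 0 ≤ lam0.im)
    (h : 0 ≤ lam.im) (hdet : (gramMatrix Q lam0 lam).det ≠ 0) :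
    (normingFunction Q lam0 lam).IsSymm :=
  (isSymm_component (isotropicComplement_isotropic hQ h0) (coeffPlusR_isotropic hQ h)
    isotropicComplement_mul_coeffPlusR hdet (coeffMinusL_isotropic hQ h)).neg

/-- The remainder of the expansion of `ψ_{-L} adj a` along `ψ_{+R}`, divided by `det a`. -/
def remainderFunction (Q : ℝ → ℝ → Matrix (Fin 2) (Fin 2) ℂ) (lam0 lam : ℂ) :
    Matrix BlockIdx (Fin 2) ℂ :=
  isotropicComplement Q lam0 * ((gramMatrix Q lam0 lam)ᵀ)⁻¹

/-- The component of ψ_{-L} along the complement contains a = rᵀJp as its right factor, and a adj a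
= det a. -/
theorem coeffMinusL_mul_adjugate (hQ : IsDecayingGPSolution Q) (h0 : 0 ≤ lam0.im)
    (h : 0 ≤ lam.im) (hdet : (gramMatrix Q lam0 lam).det ≠ 0) :
    coeffMinusL Q lam * (scatA Q lam).adjugate
      = (scatA Q lam).det • remainderFunction Q lam0 lam
        + coeffPlusR Q lam * normingFunction Q lam0 lam := by
  have hdec := isotropic_decomposition (isotropicComplement_isotropic hQ h0)
    (coeffPlusR_isotropic hQ h) isotropicComplement_mul_coeffPlusR hdet
  have ha := scatA_eq hQ h
  rw [← Matrix.one_mul (coeffMinusL Q lam), ← hdec, Matrix.sub_mul, Matrix.sub_mul,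
    sub_eq_add_neg]
  congr 1
  · calc _ = isotropicComplement Q lam0 * (((gramMatrix Q lam0 lam)ᵀ)⁻¹ *
        (((coeffPlusR Q lam)ᵀ * J (Fin 2) ℂ * coeffMinusL Q lam) * (scatA Q lam).adjugate)) := by
          simp only [Matrix.mul_assoc]
      _ = _ := by
          rw [← ha, mul_adjugate, Matrix.mul_smul, Matrix.mul_smul, Matrix.mul_one,
            remainderFunction]
  · rw [normingFunction, ← ha, Matrix.mul_neg]
    simp only [Matrix.mul_assoc]

/-- The derivatives of `ψ_{-L} adj a` at a zero of `det a`. -/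
theorem matIterDeriv_psiMinusL_mul_adjugate (hQ : IsDecayingGPSolution Q) (h0 : 0 < lam0.im)
    {N n : ℕ} (hN : (N : ℕ∞) ≤ analyticOrderAt (fun lam => (scatA Q lam).det) lam0) (hn : n < N)
    (x t : ℝ) :
    matIterDeriv n (fun lam => psiMinusL Q x t lam * (scatA Q lam).adjugate) lam0
      = matIterDeriv n (fun lam => psiPlusR Q x t lam * normingFunction Q lam0 lam) lam0 := by
  have hscat : (scatA Q) =ᶠ[𝓝 lam0]
      fun lam => (coeffPlusR Q lam)ᵀ * J (Fin 2) ℂ * coeffMinusL Q lam :=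
    (eventually_im_pos h0).mono fun lam h => scatA_eq hQ h.le
  have hdet : AnalyticAt ℂ (fun lam => (scatA Q lam).det) lam0 :=
    (matAnalyticAt_scatA_formula hQ h0).det.congr
      (hscat.mono fun lam h => (congrArg Matrix.det h).symm)
  have hR : MatAnalyticAt (fun lam => laxFlow Q x t lam * coeffPlusR Q lam
      * normingFunction Q lam0 lam) lam0 :=
    ((matAnalyticAt_laxFlow hQ x t).mul (matAnalyticAt_coeffPlusR hQ h0)).mul
      (matAnalyticAt_normingFunction hQ h0)
  have hrem : MatAnalyticAt (fun lam => laxFlow Q x t lam * remainderFunction Q lam0 lam) lam0 :=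
    (matAnalyticAt_laxFlow hQ x t).mul ((matAnalyticAt_const _).mul
      ((matAnalyticAt_gramMatrix hQ h0).transpose.inv (by
        rw [det_transpose]; exact det_gramMatrix_ne_zero hQ h0.le)))
  have h1 : (fun lam => psiMinusL Q x t lam * (scatA Q lam).adjugate) =ᶠ[𝓝 lam0]
      fun lam => (scatA Q lam).det • (laxFlow Q x t lam * remainderFunction Q lam0 lam)
        + laxFlow Q x t lam * coeffPlusR Q lam * normingFunction Q lam0 lam := by
    filter_upwards [eventually_im_pos h0, eventually_det_gramMatrix_ne_zero hQ h0] with lam h hd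
    rw [psiMinusL_eq hQ h.le, Matrix.mul_assoc, coeffMinusL_mul_adjugate hQ h0.le h.le hd,
      Matrix.mul_add, Matrix.mul_smul, Matrix.mul_assoc]
  have h2 : (fun lam => psiPlusR Q x t lam * normingFunction Q lam0 lam) =ᶠ[𝓝 lam0]
      fun lam => laxFlow Q x t lam * coeffPlusR Q lam * normingFunction Q lam0 lam :=
    (eventually_im_pos h0).mono fun lam h => by simp only [psiPlusR_eq hQ h.le]
  rw [matIterDeriv_congr h1, matIterDeriv_congr h2,
    matIterDeriv_add (MatAnalyticAt.smul hdet hrem) hR,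
    matIterDeriv_smul_eq_zero hdet hrem hN hn, zero_add]

theorem matAnalyticAt_psiPlusR (hQ : IsDecayingGPSolution Q) (h0 : 0 < lam0.im) (x t : ℝ) :
    MatAnalyticAt (fun lam => psiPlusR Q x t lam) lam0 := fun i j =>
  (((matAnalyticAt_laxFlow hQ x t).mul (matAnalyticAt_coeffPlusR hQ h0)) i j).congr
    ((eventually_im_pos h0).mono fun lam h => by simp only [psiPlusR_eq hQ h.le])

theorem matAnalyticAt_psiMinusL_mul_adjugate (hQ : IsDecayingGPSolution Q) (h0 : 0 < lam0.im)
    (x t : ℝ) :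
    MatAnalyticAt (fun lam => psiMinusL Q x t lam * (scatA Q lam).adjugate) lam0 := fun i j =>
  ((((matAnalyticAt_laxFlow hQ x t).mul (matAnalyticAt_coeffMinusL hQ h0)).mul
    (matAnalyticAt_scatA_formula hQ h0).adjugate) i j).congr
    ((eventually_im_pos h0).mono fun lam h => by
      simp only [psiMinusL_eq hQ h.le, scatA_eq hQ h.le])

theorem eventually_conj_im_nonneg (h0 : 0 < lam0.im) :
    ∀ᶠ z in 𝓝 (starRingEnd ℂ lam0), 0 ≤ (starRingEnd ℂ z).im :=
  ((Complex.continuous_conj.tendsto' _ lam0 (by simp)).eventually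
    (eventually_im_pos h0)).mono fun _ h => h.le

theorem matIterDeriv_psiPlusL (hQ : IsDecayingGPSolution Q) (h0 : 0 < lam0.im) (n : ℕ)
    (x t : ℝ) :
    matIterDeriv n (fun z => psiPlusL Q x t z) (starRingEnd ℂ lam0)
      = -J (Fin 2) ℂ * mconj (matIterDeriv n (fun lam => psiPlusR Q x t lam) lam0) := by
  rw [← matIterDeriv_mul_conj_conj _ (matAnalyticAt_psiPlusR hQ h0 x t)]
  refine matIterDeriv_congr ((eventually_conj_im_nonneg h0).mono fun z hz => ?_) n
  have h := psiPlusL_conj hQ hz x t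
  rw [starRingEnd_self_apply, ← psiPlusR_eq hQ hz] at h
  simp only [h, Matrix.neg_mul]

theorem matIterDeriv_psiMinusR_mul_adjugate (hQ : IsDecayingGPSolution Q) (h0 : 0 < lam0.im)
    (n : ℕ) (x t : ℝ) :
    matIterDeriv n (fun z => psiMinusR Q x t z * (scatAConj Q z).adjugate) (starRingEnd ℂ lam0)
      = J (Fin 2) ℂ * mconj
        (matIterDeriv n (fun lam => psiMinusL Q x t lam * (scatA Q lam).adjugate) lam0) := by
  rw [← matIterDeriv_mul_conj_conj _ (matAnalyticAt_psiMinusL_mul_adjugate hQ h0 x t)]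
  refine matIterDeriv_congr ((eventually_conj_im_nonneg h0).mono fun z hz => ?_) n
  have h := psiMinusR_conj hQ hz x t
  rw [starRingEnd_self_apply, ← psiMinusL_eq hQ hz] at h
  have hadj : (scatAConj Q z).adjugate = mconj (scatA Q (starRingEnd ℂ z)).adjugate :=
    ((starRingEnd ℂ).map_adjugate _).symm
  simp only [h, hadj, mconj_mul, Matrix.mul_assoc]

/-- At λ₀ the decomposition reads p adj a = r β, so β = 0 forces adj a = 0 by injectivity of p; the
converse is read off from the factor adj a in β. -/
theorem normingFunction_eq_zero_iff (hQ : IsDecayingGPSolution Q) (h0 : 0 < lam0.im)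
    (hdet : (scatA Q lam0).det = 0) : normingFunction Q lam0 lam0 = 0 ↔ scatA Q lam0 = 0 := by
  have h := coeffMinusL_mul_adjugate hQ h0.le h0.le (det_gramMatrix_ne_zero hQ h0.le)
  rw [hdet, zero_smul, zero_add] at h
  constructor
  · intro hB
    rw [hB, Matrix.mul_zero] at h
    have hadj : (scatA Q lam0).adjugate = 0 := by
      refine ext_of_mulVec_single fun j => ?_
      rw [zero_mulVec]
      refine coeffMinusL_injective hQ h0.le _ ?_
      rw [mulVec_mulVec, h, zero_mulVec]
    -- In size 2 the power of det a in adj adj a has exponent 0, so a is recovered although it is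
    -- singular.
    have h2 := adjugate_adjugate (scatA Q lam0) (by simp)
    rw [hadj] at h2
    simpa using h2.symm
  · intro ha
    rw [normingFunction, ← scatA_eq hQ h0.le, ha, adjugate_fin_two]
    ext i j
    fin_cases i <;> fin_cases j <;> simp [Matrix.mul_apply]

theorem matIterDeriv_normingFunction_isSymm (hQ : IsDecayingGPSolution Q) (h0 : 0 < lam0.im)
    (n : ℕ) : (matIterDeriv n (normingFunction Q lam0) lam0).IsSymm := by
  have h : (fun lam => (normingFunction Q lam0 lam)ᵀ) =ᶠ[𝓝 lam0] normingFunction Q lam0 := by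
    filter_upwards [eventually_im_pos h0, eventually_det_gramMatrix_ne_zero hQ h0] with lam h hd
    exact normingFunction_isSymm hQ h0.le h.le hd
  exact matIterDeriv_congr h n

/-- The expansion of `ψ_{-L} adj a` with the norming constants. -/
theorem factorial_inv_smul_matIterDeriv_psiMinusL (hQ : IsDecayingGPSolution Q)
    (h0 : 0 < lam0.im) {N n : ℕ}
    (hN : (N : ℕ∞) ≤ analyticOrderAt (fun lam => (scatA Q lam).det) lam0) (hn : n < N)
    (x t : ℝ) :
    ((n.factorial : ℂ))⁻¹ •
        matIterDeriv n (fun lam => psiMinusL Q x t lam * (scatA Q lam).adjugate) lam0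
      = ∑ p ∈ Finset.HasAntidiagonal.antidiagonal n,
          ((p.1.factorial : ℂ) * (p.2.factorial : ℂ))⁻¹ •
            (matIterDeriv p.2 (fun lam => psiPlusR Q x t lam) lam0
              * matIterDeriv p.1 (normingFunction Q lam0) lam0) := by
  rw [matIterDeriv_psiMinusL_mul_adjugate hQ h0 hN hn,
    matIterDeriv_mul (matAnalyticAt_psiPlusR hQ h0 x t) (matAnalyticAt_normingFunction hQ h0)]

/-- The expansion of `ψ_{-R} adj ā` with the norming constants. -/
theorem factorial_inv_smul_matIterDeriv_psiMinusR (hQ : IsDecayingGPSolution Q)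
    (h0 : 0 < lam0.im) {N n : ℕ}
    (hN : (N : ℕ∞) ≤ analyticOrderAt (fun lam => (scatA Q lam).det) lam0) (hn : n < N)
    (x t : ℝ) :
    ((n.factorial : ℂ))⁻¹ •
        matIterDeriv n (fun z => psiMinusR Q x t z * (scatAConj Q z).adjugate) (starRingEnd ℂ lam0)
      = -∑ p ∈ Finset.HasAntidiagonal.antidiagonal n,
          ((p.1.factorial : ℂ) * (p.2.factorial : ℂ))⁻¹ •
            (matIterDeriv p.2 (fun z => psiPlusL Q x t z) (starRingEnd ℂ lam0)
              * (matIterDeriv p.1 (normingFunction Q lam0) lam0)ᴴ) := by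
  have h := congrArg (fun M => J (Fin 2) ℂ * mconj M)
    (factorial_inv_smul_matIterDeriv_psiMinusL hQ h0 hN hn x t)
  have hsum : ∀ (s : Finset (ℕ × ℕ)) (f : ℕ × ℕ → Matrix BlockIdx (Fin 2) ℂ),
      mconj (∑ p ∈ s, f p) = ∑ p ∈ s, mconj (f p) := fun s f => by
    ext i j
    simp [Matrix.sum_apply]
  simp only [mconj_smul, hsum, mconj_mul, Matrix.mul_smul, Matrix.mul_sum, map_inv₀, map_mul,
    map_natCast] at h
  rw [matIterDeriv_psiMinusR_mul_adjugate hQ h0, h, ← Finset.sum_neg_distrib]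
  refine Finset.sum_congr rfl fun p _ => ?_
  -- Reflection produces the entrywise conjugate of the norming constant; symmetry turns it into the
  -- conjugate transpose. The minus sign comes from ψ_{+L} = -J ψ̄_{+R}.
  have hB : (matIterDeriv p.1 (normingFunction Q lam0) lam0)ᴴ
      = mconj (matIterDeriv p.1 (normingFunction Q lam0) lam0) := by
    rw [conjTranspose, (matIterDeriv_normingFunction_isSymm hQ h0 p.1).eq]
    rfl
  rw [matIterDeriv_psiPlusL hQ h0, hB, Matrix.neg_mul, Matrix.neg_mul, smul_neg, neg_neg,
    Matrix.mul_assoc]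

end NormingConstants

/-! ### The expansions at a zero of det a. -/

theorem mainTheorem5 (Q : ℝ → ℝ → Matrix (Fin 2) (Fin 2) ℂ) (hQ : IsDecayingGPSolution Q)
    (lam0 : ℂ) (hlam0 : 0 < lam0.im) (m : ℕ)
    (hm : analyticOrderAt (fun lam : ℂ => (scatA Q lam).det) lam0 = ((m + 1 : ℕ) : ℕ∞)) :
    ∃ B : Fin (m + 1) → Matrix (Fin 2) (Fin 2) ℂ,
      (∀ j, (B j).IsSymm) ∧
      (B 0 ≠ 0 ↔ scatA Q lam0 ≠ 0) ∧
      ∀ (n : Fin (m + 1)) (x t : ℝ),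
        ((n : ℕ).factorial : ℂ)⁻¹ •
            matIterDeriv n (fun lam => psiMinusL Q x t lam * (scatA Q lam).adjugate) lam0
          = ∑ j : Fin (m + 1), ∑ k : Fin (m + 1),
              (if (j : ℕ) + (k : ℕ) = n then
                (((j : ℕ).factorial : ℂ) * ((k : ℕ).factorial : ℂ))⁻¹ •
                  (matIterDeriv k (fun lam => psiPlusR Q x t lam) lam0 * B j)
              else 0) ∧
        ((n : ℕ).factorial : ℂ)⁻¹ •
            matIterDeriv n (fun z => psiMinusR Q x t z * (scatAConj Q z).adjugate)
              (starRingEnd ℂ lam0)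
          = -∑ j : Fin (m + 1), ∑ k : Fin (m + 1),
              (if (j : ℕ) + (k : ℕ) = n then
                (((j : ℕ).factorial : ℂ) * ((k : ℕ).factorial : ℂ))⁻¹ •
                  (matIterDeriv k (fun z => psiPlusL Q x t z) (starRingEnd ℂ lam0)
                    * (B j).conjTranspose)
              else 0) := by

  have hN : ((m + 1 : ℕ) : ℕ∞) ≤ analyticOrderAt (fun lam => (scatA Q lam).det) lam0 := hm.ge
  have hdet : (scatA Q lam0).det = 0 := by
    refine apply_eq_zero_of_analyticOrderAt_ne_zero (f := fun lam => (scatA Q lam).det) ?_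
    rw [hm]
    exact_mod_cast m.succ_ne_zero
  -- Plain derivatives, not Taylor coefficients: the factor 1/j! is already in the sums.
  refine ⟨fun j => matIterDeriv j (normingFunction Q lam0) lam0,
    fun j => matIterDeriv_normingFunction_isSymm hQ hlam0 j, ?_, fun n x t => ⟨?_, ?_⟩⟩
  · change matIterDeriv 0 _ _ ≠ 0 ↔ _
    rw [matIterDeriv_zero, ne_eq, normingFunction_eq_zero_iff hQ hlam0 hdet]
  · rw [factorial_inv_smul_matIterDeriv_psiMinusL hQ hlam0 hN n.2]
    exact (sum_sum_ite_eq_sum_antidiagonal n.2 fun j k =>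
      ((j.factorial : ℂ) * (k.factorial : ℂ))⁻¹ •
        (matIterDeriv k (fun lam => psiPlusR Q x t lam) lam0
          * matIterDeriv j (normingFunction Q lam0) lam0)).symm
  · rw [factorial_inv_smul_matIterDeriv_psiMinusR hQ hlam0 hN n.2]
    exact congrArg Neg.neg (sum_sum_ite_eq_sum_antidiagonal n.2 fun j k =>
      ((j.factorial : ℂ) * (k.factorial : ℂ))⁻¹ •
        (matIterDeriv k (fun z => psiPlusL Q x t z) (starRingEnd ℂ lam0)
          * (matIterDeriv j (normingFunction Q lam0) lam0).conjTranspose)).symm
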